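/- Work over $\mathbb{C}$. Let $\mathcal{G}_{1,d}\subset\mathbb{P}^d$ be the Gaussian moment variety, i.e. the Zariski closure of the set of points $(m_0:m_1:\cdots:m_d)$ given by $\sum_i \frac{m_i}{i!}t^i=\exp(\mu t+\tfrac12\sigma^2t^2)$, and let $\sigma_2(\mathcal{G}_{1,d})$ be its variety of secant lines, i.e. the Zariski closure of the union of the lines spanned by two points of $\mathcal{G}_{1,d}$. On $\mathbb{A}^d=\{m_0=1\}$ use the cumulant coordinates $k_1,\dots,k_d$ defined by $\sum_i \frac{m_i}{i!}t^i=\exp\bigl(\sum_{i\ge1}\frac{k_i}{i!}t^i\bigr)$, and let $J_d\subset\mathbb{C}[k_1,\dots,k_d]$ be the ideal of all polynomials vanishing on $\sigma_2(\mathcal{G}_{1,d})\cap\mathbb{A}^d$ in these coordinates. Consider the following polynomials in $k_2,\dots,k_8,s,p$: $$f_4=-2p^2s^2-4spk_3+6p^3+3k_4p+k_3^2,$$ $$f_5=-2p^2s^3+4p^3s+5sk_3^2-20p^2k_3+3k_5p,$$ $$\begin{aligned}f_6={}&-144p^5+(72s^2-270k_2)p^4+(90s^2k_2+180sk_3-4s^4)p^3\\&+(-135k_2k_4+180sk_2k_3-30s^3k_3-90k_3^2-9k_6)p^2-30k_3^2\bigl(s^2+\tfrac32k_2\bigr)p+5sk_3^3,\end{aligned}$$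 $$\begin{aligned}f_7={}&16p^3s^5-126k_2p^3s^3+42k_3p^2s^4-148p^4s^3+252k_2p^4s-126k_3p^3s^2+216p^5s\\&+315k_2k_3^2ps-1260k_2k_3p^3-35k_3^3s^2+210k_3^2p^2s-378k_3p^4+189k_2k_5p^2\\&+35k_3^3p+315k_3k_4p^2+9k_7p^2,\end{aligned}$$ $$\begin{aligned}f_8={}&20p^4s^6+336k_2p^4s^4-112k_3p^3s^5+124p^5s^4-3780k_2^2p^4s^2+2520k_2k_3p^3s^3\\&-6048k_2p^5s^2-420k_3^2p^2s^4+2128k_3p^4s^3-2232p^6s^2-7560k_2^2k_3p^3s+11340k_2^2p^5\\&+2520k_2k_3^2p^2s^2-15120k_2k_3p^4s+12096k_2p^6-280k_3^3ps^3+2940k_3^2p^3s^2-7056k_3p^5s\\&+3564p^7+1890k_2^2k_3^2p^2+5670k_2^2k_4p^3-420k_2k_3^3ps+7560k_2k_3^2p^3+35k_3^4s^2\\&+280k_3^3p^2s-1260k_3^2p^4+756k_2k_6p^3-35k_3^4p+1512k_3k_5p^3+945k_4^2p^3+27k_8p^3.\end{aligned}$$ Let $I_7=\langle f_4,f_5,f_6,f_7\rangle\subset\mathbb{C}[k_1,\dots,k_7,s,p]$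 and $I_8=\langle f_4,f_5,f_6,f_7,f_8\rangle\subset\mathbb{C}[k_1,\dots,k_8,s,p]$. **Proposition.** For $d=7$ and $d=8$ the affine variety $\sigma_2(\mathcal{G}_{1,d})\cap\mathbb{A}^d$ has dimension $5$ (the Krull dimension of $\mathbb{C}[k_1,\dots,k_d]/J_d$ is $5$), and its ideal $J_d$ is obtained from $I_d$ by eliminating $s$ and $p$ and removing the extraneous factor $k_3$, that is, $$J_d=\bigl(I_d\cap\mathbb{C}[k_1,\dots,k_d]\bigr):k_3^\infty .$$ Equivalently, $J_d$ is the elimination ideal of the system in which $p$ is invertible: $J_d=(I_d:p^\infty)\cap\mathbb{C}[k_1,\dots,k_d]$. -/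

import Mathlib

open MvPolynomial
open scoped LinearAlgebra.Projectivization

noncomputable section

/-! ### Moments and generating functions -/

/-- The moment vector `(m₀, …, m_d)` whose exponential generating function
`∑ mᵢ tⁱ / i!` agrees with `M` up to order `d`. -/
def momentVector (d : ℕ) (M : PowerSeries ℂ) : Fin (d + 1) → ℂ :=
  fun i => (Nat.factorial i : ℂ) * PowerSeries.coeff (i : ℕ) M

/-- The formal power series `exp(K)`; meaningful when `K` has constant term `0`. -/
def expSeries (K : PowerSeries ℂ) : PowerSeries ℂ := (PowerSeries.exp ℂ).subst K

/-- `exp(K)` has constant term `1`, so its moment vector has `m₀ = 1` and is nonzero. -/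
theorem momentVector_expSeries_zero (d : ℕ) {K : PowerSeries ℂ}
    (hK : PowerSeries.constantCoeff K = 0) : momentVector d (expSeries K) 0 = 1 := by
  have h0 : MvPowerSeries.constantCoeff K = 0 := by
    rw [← hK]; rfl
  have h : PowerSeries.constantCoeff ((PowerSeries.exp ℂ - 1).subst K) = 0 :=
    PowerSeries.constantCoeff_subst_eq_zero h0 _ (by simp [PowerSeries.constantCoeff_exp])
  have hs : PowerSeries.HasSubst K := PowerSeries.HasSubst.of_constantCoeff_zero' hK
  have h1 : (PowerSeries.exp ℂ).subst K
      = (PowerSeries.exp ℂ - 1).subst K + (1 : PowerSeries ℂ) := by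
    have h2 := PowerSeries.subst_add (a := K) hs (PowerSeries.exp ℂ - 1) 1
    rw [sub_add_cancel] at h2
    rw [h2]
    congr 1
    rw [← PowerSeries.coe_substAlgHom hs, map_one]
  simp [momentVector, expSeries, h1, h]

theorem momentVector_expSeries_ne_zero (d : ℕ) {K : PowerSeries ℂ}
    (hK : PowerSeries.constantCoeff K = 0) : momentVector d (expSeries K) ≠ 0 := by
  intro h
  have h1 := momentVector_expSeries_zero d hK
  rw [h] at h1
  simp at h1

/-- The point `(m₀ : m₁ : ⋯ : m_d)` of `ℙ^d` with moment generating function `M = exp(K)`,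
where `K` has constant term `0`; it lies in the chart `m₀ = 1`. -/
def expPoint (d : ℕ) (K : PowerSeries ℂ) (hK : PowerSeries.constantCoeff K = 0) :
    ℙ ℂ (Fin (d + 1) → ℂ) :=
  Projectivization.mk ℂ (momentVector d (expSeries K)) (momentVector_expSeries_ne_zero d hK)

/-! ### Gaussian moment varieties and their secant varieties -/

/-- Zariski closure of a set of points in projective space: the common zeros of all
homogeneous polynomials that vanish on the set. -/
def projectiveClosure {N : ℕ} (S : Set (ℙ ℂ (Fin N → ℂ))) : Set (ℙ ℂ (Fin N → ℂ)) :=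
  {x | ∀ (F : MvPolynomial (Fin N) ℂ) (e : ℕ), F.IsHomogeneous e →
    (∀ y ∈ S, eval y.rep F = 0) → eval x.rep F = 0}

/-- The logarithm `μ t + v t² / 2` of the moment generating function of a univariate Gaussian
with mean `μ` and variance `v`. -/
def gaussianLog (μ v : ℂ) : PowerSeries ℂ :=
  PowerSeries.C μ * PowerSeries.X + PowerSeries.C (v / 2) * PowerSeries.X ^ 2

theorem constantCoeff_gaussianLog (μ v : ℂ) :
    PowerSeries.constantCoeff (gaussianLog μ v) = 0 := by
  simp [gaussianLog]

/-- The Gaussian moment variety `𝒢_{1,d} ⊆ ℙ^d`: the Zariski closure of the set of moment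
vectors `(m₀ : ⋯ : m_d)` given by `∑ mᵢ tⁱ / i! = exp(μ t + v t² / 2)`. -/
def gaussianMomentVariety (d : ℕ) : Set (ℙ ℂ (Fin (d + 1) → ℂ)) :=
  projectiveClosure
    {x | ∃ μ v : ℂ, x = expPoint d (gaussianLog μ v) (constantCoeff_gaussianLog μ v)}

/-- The `k`-th secant variety `σ_k(V)`: the Zariski closure of the union of the linear spans of
`k`-tuples of points of `V`. -/
def secantVariety {N : ℕ} (k : ℕ) (V : Set (ℙ ℂ (Fin N → ℂ))) : Set (ℙ ℂ (Fin N → ℂ)) :=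
  projectiveClosure
    {z | ∃ y : Fin k → ℙ ℂ (Fin N → ℂ), (∀ i, y i ∈ V) ∧
      z.submodule ≤ ⨆ i, (y i).submodule}

/-! ### Cumulant coordinates

Coordinates on `Fin d → ℂ` are numbered from `0`: the entry with index `i` is the cumulant
`k_{i+1}`. -/

/-- The cumulant generating function `K = ∑_{i=1}^{d} kᵢ tⁱ / i!`. -/
def cumulantSeries (d : ℕ) (κ : Fin d → ℂ) : PowerSeries ℂ :=
  ∑ i : Fin d, PowerSeries.C (κ i / (Nat.factorial ((i : ℕ) + 1) : ℂ)) *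
    PowerSeries.X ^ ((i : ℕ) + 1)

theorem constantCoeff_cumulantSeries (d : ℕ) (κ : Fin d → ℂ) :
    PowerSeries.constantCoeff (cumulantSeries d κ) = 0 := by
  simp [cumulantSeries, map_sum]

/-- The affine variety `σ₂(𝒢_{1,d}) ∩ 𝔸^d`, where `𝔸^d = {m₀ = 1}`, in cumulant coordinates:
moments and cumulants of order at most `d` are related by `M = exp(K)`. -/
def secantInCumulants (d : ℕ) : Set (Fin d → ℂ) :=
  {κ | expPoint d (cumulantSeries d κ) (constantCoeff_cumulantSeries d κ) ∈
    secantVariety 2 (gaussianMomentVariety d)}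

/-- The ideal of `σ₂(𝒢_{1,d}) ∩ 𝔸^d` in the polynomial ring `ℂ[k₁, …, k_d]`. -/
def secantIdeal (d : ℕ) : Ideal (MvPolynomial (Fin d) ℂ) :=
  vanishingIdeal ℂ (secantInCumulants d)

/-! ### The polynomial systems -/

section Polynomials

variable {R : Type*} [CommRing R]

/-- The equation that contains `k₄` linearly. -/
def eqFour (k3 k4 s p : R) : R :=
  -2*p^2*s^2 - 4*s*p*k3 + 6*p^3 + 3*k4*p + k3^2

/-- The equation that contains `k₅` linearly. -/
def eqFive (k3 k5 s p : R) : R :=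
  -2*p^2*s^3 + 4*p^3*s + 5*s*k3^2 - 20*p^2*k3 + 3*k5*p

/-- The equation that contains `k₆` linearly. -/
def eqSix (k2 k3 k4 k6 s p : R) : R :=
  -144*p^5 + (72*s^2 - 270*k2)*p^4 + (90*s^2*k2 + 180*s*k3 - 4*s^4)*p^3
    + (-135*k2*k4 + 180*s*k2*k3 - 30*s^3*k3 - 90*k3^2 - 9*k6)*p^2
    - (30*k3^2*s^2 + 45*k3^2*k2)*p + 5*s*k3^3

/-- The equation that contains `k₇` linearly. -/
def eqSeven (k2 k3 k4 k5 k7 s p : R) : R :=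
  16*p^3*s^5 - 126*k2*p^3*s^3 + 42*k3*p^2*s^4 - 148*p^4*s^3 + 252*k2*p^4*s
    - 126*k3*p^3*s^2 + 216*p^5*s + 315*k2*k3^2*p*s - 1260*k2*k3*p^3 - 35*k3^3*s^2
    + 210*k3^2*p^2*s - 378*k3*p^4 + 189*k2*k5*p^2 + 35*k3^3*p + 315*k3*k4*p^2 + 9*k7*p^2

/-- The equation that contains `k₈` linearly. -/
def eqEight (k2 k3 k4 k5 k6 k8 s p : R) : R :=
  20*p^4*s^6 + 336*k2*p^4*s^4 - 112*k3*p^3*s^5 + 124*p^5*s^4 - 3780*k2^2*p^4*s^2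
    + 2520*k2*k3*p^3*s^3 - 6048*k2*p^5*s^2 - 420*k3^2*p^2*s^4 + 2128*k3*p^4*s^3
    - 2232*p^6*s^2 - 7560*k2^2*k3*p^3*s + 11340*k2^2*p^5 + 2520*k2*k3^2*p^2*s^2
    - 15120*k2*k3*p^4*s + 12096*k2*p^6 - 280*k3^3*p*s^3 + 2940*k3^2*p^3*s^2
    - 7056*k3*p^5*s + 3564*p^7
    + 1890*k2^2*k3^2*p^2 + 5670*k2^2*k4*p^3 - 420*k2*k3^3*p*s
    + 7560*k2*k3^2*p^3 + 35*k3^4*s^2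
    + 280*k3^3*p^2*s - 1260*k3^2*p^4 + 756*k2*k6*p^3 - 35*k3^4*p + 1512*k3*k5*p^3
    + 945*k4^2*p^3 + 27*k8*p^3

end Polynomials

/-- The variable `k_{i+1}` of the polynomial ring `ℂ[k₁, …, k_d, s, p]`. -/
def kVar {d : ℕ} (i : Fin d) : MvPolynomial (Fin d ⊕ Fin 2) ℂ := X (Sum.inl i)

/-- The variable `s` of `ℂ[k₁, …, k_d, s, p]`. -/
def sVar {d : ℕ} : MvPolynomial (Fin d ⊕ Fin 2) ℂ := X (Sum.inr 0)

/-- The variable `p` of `ℂ[k₁, …, k_d, s, p]`. -/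
def pVar {d : ℕ} : MvPolynomial (Fin d ⊕ Fin 2) ℂ := X (Sum.inr 1)

/-- The ideal of `ℂ[k₁, …, k₇, s, p]` generated by the four equations in which
`k₄, k₅, k₆, k₇` occur linearly. -/
def systemSeven : Ideal (MvPolynomial (Fin 7 ⊕ Fin 2) ℂ) :=
  Ideal.span
    {eqFour (kVar 2) (kVar 3) sVar pVar,
     eqFive (kVar 2) (kVar 4) sVar pVar,
     eqSix (kVar 1) (kVar 2) (kVar 3) (kVar 5) sVar pVar,
     eqSeven (kVar 1) (kVar 2) (kVar 3) (kVar 4) (kVar 6) sVar pVar}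

/-- The ideal of `ℂ[k₁, …, k₈, s, p]` generated by the five equations in which
`k₄, k₅, k₆, k₇, k₈` occur linearly. -/
def systemEight : Ideal (MvPolynomial (Fin 8 ⊕ Fin 2) ℂ) :=
  Ideal.span
    {eqFour (kVar 2) (kVar 3) sVar pVar,
     eqFive (kVar 2) (kVar 4) sVar pVar,
     eqSix (kVar 1) (kVar 2) (kVar 3) (kVar 5) sVar pVar,
     eqSeven (kVar 1) (kVar 2) (kVar 3) (kVar 4) (kVar 6) sVar pVar,
     eqEight (kVar 1) (kVar 2) (kVar 3) (kVar 4) (kVar 5) (kVar 7) sVar pVar}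

/-- Elimination of `s` and `p`: the intersection `I ∩ ℂ[k₁, …, k_d]`. -/
def eliminate {d : ℕ} (I : Ideal (MvPolynomial (Fin d ⊕ Fin 2) ℂ)) :
    Ideal (MvPolynomial (Fin d) ℂ) :=
  I.comap (rename Sum.inl : MvPolynomial (Fin d) ℂ →ₐ[ℂ] MvPolynomial (Fin d ⊕ Fin 2) ℂ)

/-- The saturation `I : f^∞`. -/
def saturate {R : Type*} [CommRing R] (I : Ideal R) (f : R) : Ideal R where
  carrier := {g | ∃ n : ℕ, f ^ n * g ∈ I}
  zero_mem' := ⟨0, by simp⟩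
  add_mem' := by
    rintro a b ⟨m, hm⟩ ⟨n, hn⟩
    refine ⟨m + n, ?_⟩
    have h : f ^ (m + n) * (a + b) = f ^ n * (f ^ m * a) + f ^ m * (f ^ n * b) := by ring
    rw [h]
    exact I.add_mem (I.mul_mem_left _ hm) (I.mul_mem_left _ hn)
  smul_mem' := by
    rintro c a ⟨n, hn⟩
    refine ⟨n, ?_⟩
    have h : f ^ n * (c • a) = c * (f ^ n * a) := by rw [smul_eq_mul]; ring
    rw [h]
    exact I.mul_mem_left _ hn

end

/-! A generic point of the secant variety is a signed mixture of two Gaussians. Let m be its mean, m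
+ a and m + b the means of the components. The centred mean vanishes, which forces the weights to be
-b/(a-b) and a/(a-b). The two variances are written c + ra and c + rb. With s = a + b and p = ab the
cumulants are k₁ = m, k₂ = c - p, and every higher cumulant is a polynomial in s, p, r alone
(`skewCumulant`). So the secant variety is the closure of the image of a polynomial map from 𝔸⁵, and
J_d is the kernel of the ring map `mixtureMap d` (`secantIdeal_eq_ker`, for d ≤ 8, the range of the
explicit moment formulas).

Since k₃ = -p(s + 3r), inverting p recovers r from k₃, s, p. Substituting the parametrization into
f_j gives a nonzero constant times a power of p times k_j minus its parametrized value
(`eqFour_skew` to `eqEight_skew`). Hence modulo I_d, with p inverted, everything reduces to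
ℂ[k₁,k₂,k₃,s,p,p⁻¹], on whose variables the parametrization imposes no relation. This gives J_d =
(I_d : p^∞) ∩ ℂ[k]. Moreover f₄ puts k₃² in the ideal generated by p modulo I_d, so a power of p may
be traded for a power of k₃. Conversely k₃ is a nonzerodivisor modulo the prime J_d.

For the dimension, ℂ[k]/J_d embeds in a polynomial ring in five variables, so its transcendence
degree is at most 5. Equality holds because k₁,…,k₅ are algebraically independent
(`ker_mixtureMap_five`): a relation may be assumed not divisible by k₃, but the image contains a
dense subset of the hyperplane k₃ = 0. -/

/-! ### Exponentials of power series; moments versus cumulants -/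

theorem constantCoeff_expSeries {K : PowerSeries ℂ} (hK : PowerSeries.constantCoeff K = 0) :
    PowerSeries.constantCoeff (expSeries K) = 1 := by
  simpa [momentVector] using momentVector_expSeries_zero 0 hK

theorem derivative_expSeries {K : PowerSeries ℂ} (hK : PowerSeries.constantCoeff K = 0) :
    PowerSeries.derivative ℂ (expSeries K) = expSeries K * PowerSeries.derivative ℂ K := by
  unfold expSeries
  rw [PowerSeries.derivative_subst (PowerSeries.HasSubst.of_constantCoeff_zero' hK),
    PowerSeries.derivative_exp]

/-- Two solutions of `f' = f * g'` with the same constant term agree up to order `d`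
when the coefficients of the two `g` do. -/
theorem coeff_eq_of_derivative_eq {f₁ f₂ g₁ g₂ : PowerSeries ℂ} {d : ℕ}
    (h₁ : PowerSeries.derivative ℂ f₁ = f₁ * PowerSeries.derivative ℂ g₁)
    (h₂ : PowerSeries.derivative ℂ f₂ = f₂ * PowerSeries.derivative ℂ g₂)
    (h0 : PowerSeries.constantCoeff f₁ = PowerSeries.constantCoeff f₂)
    (hg : ∀ n ≤ d, PowerSeries.coeff n g₁ = PowerSeries.coeff n g₂) :
    ∀ n ≤ d, PowerSeries.coeff n f₁ = PowerSeries.coeff n f₂ := by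
  intro n
  induction n using Nat.strong_induction_on with
  | _ n ih =>
    intro hn
    cases n with
    | zero => simpa using h0
    | succ n =>
      have e₁ := congrArg (PowerSeries.coeff n) h₁
      have e₂ := congrArg (PowerSeries.coeff n) h₂
      rw [PowerSeries.coeff_derivative, PowerSeries.coeff_mul] at e₁ e₂
      have key : PowerSeries.coeff (n + 1) f₁ * ((n : ℂ) + 1)
          = PowerSeries.coeff (n + 1) f₂ * ((n : ℂ) + 1) := by
        rw [e₁, e₂]
        refine Finset.sum_congr rfl fun x hx => ?_
        have hx' := Finset.HasAntidiagonal.mem_antidiagonal.mp hx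
        rw [ih x.1 (by omega) (by omega), PowerSeries.coeff_derivative,
          PowerSeries.coeff_derivative, hg (x.2 + 1) (by omega)]
      exact mul_right_cancel₀ (Nat.cast_add_one_ne_zero n) key

theorem coeff_expSeries_congr {K L : PowerSeries ℂ} (hK : PowerSeries.constantCoeff K = 0)
    (hL : PowerSeries.constantCoeff L = 0) {d : ℕ}
    (h : ∀ n ≤ d, PowerSeries.coeff n K = PowerSeries.coeff n L) :
    ∀ n ≤ d, PowerSeries.coeff n (expSeries K) = PowerSeries.coeff n (expSeries L) :=
  coeff_eq_of_derivative_eq (derivative_expSeries hK) (derivative_expSeries hL)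
    (by rw [constantCoeff_expSeries hK, constantCoeff_expSeries hL]) h

theorem expSeries_add {K L : PowerSeries ℂ} (hK : PowerSeries.constantCoeff K = 0)
    (hL : PowerSeries.constantCoeff L = 0) :
    expSeries (K + L) = expSeries K * expSeries L := by
  have hKL : PowerSeries.constantCoeff (K + L) = 0 := by simp [hK, hL]
  ext n
  refine coeff_eq_of_derivative_eq (g₁ := K + L) (g₂ := K + L) (derivative_expSeries hKL) ?_ ?_
    (fun _ _ => rfl) n le_rfl
  · rw [Derivation.leibniz, derivative_expSeries hK, derivative_expSeries hL, map_add]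
    simp only [smul_eq_mul]
    ring
  · rw [map_mul, constantCoeff_expSeries hK, constantCoeff_expSeries hL,
      constantCoeff_expSeries hKL, one_mul]

/-- The moments of `exp(K)` satisfy a recursion with the cumulants as coefficients. -/
theorem coeff_succ_expSeries {K : PowerSeries ℂ} (hK : PowerSeries.constantCoeff K = 0) (n : ℕ) :
    PowerSeries.coeff (n + 1) (expSeries K) * (n + 1) =
      ∑ j ∈ Finset.range (n + 1), PowerSeries.coeff (n - j) (expSeries K) *
        (PowerSeries.coeff (j + 1) K * (j + 1)) := by
  rw [← PowerSeries.coeff_derivative, derivative_expSeries hK, mul_comm, PowerSeries.coeff_mul,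
    Finset.Nat.sum_antidiagonal_eq_sum_range_succ_mk]
  refine Finset.sum_congr rfl fun j _ => ?_
  rw [PowerSeries.coeff_derivative, mul_comm]

theorem coeff_cumulantSeries (d : ℕ) (κ : Fin d → ℂ) (i : Fin d) :
    PowerSeries.coeff ((i : ℕ) + 1) (cumulantSeries d κ) =
      κ i / (Nat.factorial ((i : ℕ) + 1) : ℂ) := by
  unfold cumulantSeries
  rw [map_sum, Finset.sum_eq_single i]
  · simp [PowerSeries.coeff_C_mul, PowerSeries.coeff_X_pow]
  · intro j _ hj
    have : ¬ ((i : ℕ) = j) := fun h => hj (Fin.ext h.symm)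
    simp [PowerSeries.coeff_C_mul, PowerSeries.coeff_X_pow, this]
  · simp

/-- Cumulants are polynomials in the moments. -/
theorem exists_cumulant_polynomial (d : ℕ) (i : Fin d) :
    ∃ c : MvPolynomial (Fin (d + 1)) ℂ, ∀ κ : Fin d → ℂ,
      eval (momentVector d (expSeries (cumulantSeries d κ))) c = κ i := by
  have key : ∀ n (hn : n < d), ∃ c : MvPolynomial (Fin (d + 1)) ℂ, ∀ κ : Fin d → ℂ,
      eval (momentVector d (expSeries (cumulantSeries d κ))) c = κ ⟨n, hn⟩ := by
    intro n
    induction n using Nat.strong_induction_on with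
    | _ n ih =>
      intro hn
      choose c hc using ih
      let M : ℕ → MvPolynomial (Fin (d + 1)) ℂ := fun j =>
        if h : j < d + 1 then C ((Nat.factorial j : ℂ)⁻¹) * X ⟨j, h⟩ else 0
      have hM : ∀ j < d + 1, ∀ κ : Fin d → ℂ,
          eval (momentVector d (expSeries (cumulantSeries d κ))) (M j) =
            PowerSeries.coeff j (expSeries (cumulantSeries d κ)) := by
        intro j hj κ
        have hf : (Nat.factorial j : ℂ) ≠ 0 := by exact_mod_cast Nat.factorial_ne_zero j
        simp only [M, hj, dif_pos, map_mul, eval_C, eval_X, momentVector]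
        field_simp
      refine ⟨C (Nat.factorial n : ℂ) * (M (n + 1) * C ((n : ℂ) + 1) -
        ∑ j ∈ (Finset.range n).attach, M (n - j) *
          (c j (Finset.mem_range.mp j.2) ((Finset.mem_range.mp j.2).trans hn) *
            C (((j : ℕ) + 1 : ℂ) / (Nat.factorial ((j : ℕ) + 1) : ℂ)))), fun κ => ?_⟩
      have hrec := coeff_succ_expSeries (constantCoeff_cumulantSeries d κ) n
      -- The term j = n carries the factor m₀ = 1, so the recursion can be solved for the new
      -- cumulant; `attach` keeps the proofs j < n that the inductive polynomials `c j` need.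
      rw [Finset.sum_range_succ, ← Finset.sum_attach] at hrec
      have h1 := coeff_cumulantSeries d κ ⟨n, hn⟩
      have h0 : PowerSeries.coeff 0 (expSeries (cumulantSeries d κ)) = 1 := by
        simpa using constantCoeff_expSeries (constantCoeff_cumulantSeries d κ)
      simp only [Nat.sub_self, h0, one_mul] at hrec
      simp only at h1
      simp only [map_mul, map_sub, map_sum, eval_C]
      rw [hM (n + 1) (by omega), hrec, h1]
      have hs : ∑ x ∈ (Finset.range n).attach,
          eval (momentVector d (expSeries (cumulantSeries d κ))) (M (n - x)) *
            (eval (momentVector d (expSeries (cumulantSeries d κ)))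
              (c x (Finset.mem_range.mp x.2) ((Finset.mem_range.mp x.2).trans hn)) *
                (((x : ℕ) + 1 : ℂ) / (Nat.factorial ((x : ℕ) + 1) : ℂ))) =
          ∑ j ∈ (Finset.range n).attach,
            PowerSeries.coeff (n - j) (expSeries (cumulantSeries d κ)) *
              (PowerSeries.coeff ((j : ℕ) + 1) (cumulantSeries d κ) * ((j : ℕ) + 1 : ℂ)) := by
        refine Finset.sum_congr rfl fun j _ => ?_
        have hj := Finset.mem_range.mp j.2
        rw [hM _ (by omega), hc j hj (hj.trans hn) κ,
          coeff_cumulantSeries d κ ⟨j, hj.trans hn⟩]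
        ring
      rw [hs, add_sub_cancel_left, Nat.factorial_succ]
      have hf : (Nat.factorial n : ℂ) ≠ 0 := by exact_mod_cast Nat.factorial_ne_zero n
      have hn1 := Nat.cast_add_one_ne_zero (R := ℂ) n
      push_cast
      field_simp
  exact key i i.2

/-! ### Cumulants and moments of a two-component Gaussian mixture -/

section Parametrization

variable {R : Type*} [CommRing R]

/-- The cumulants `k₁, k₂, …, k₈` (numbered from `0`) of the distribution with density
proportional to `-b · N(a, r a) + a · N(b, r b)`, where `s = a + b` and `p = a b`. -/
def skewCumulant (s p r : R) : ℕ → R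
  | 1 => -p
  | 2 => -s*p - 3*p*r
  | 3 => -s^2*p - 6*s*p*r - 2*p^2 - 3*p*r^2
  | 4 => -s^3*p - 10*s^2*p*r - 8*s*p^2 - 15*s*p*r^2 - 20*p^2*r
  | 5 => -s^4*p - 15*s^3*p*r - 22*s^2*p^2 - 45*s^2*p*r^2 - 120*s*p^2*r - 15*s*p*r^3 - 16*p^3
      - 90*p^2*r^2
  | 6 => -s^5*p - 21*s^4*p*r - 52*s^3*p^2 - 105*s^3*p*r^2 - 462*s^2*p^2*r - 105*s^2*p*r^3
      - 136*s*p^3 - 840*s*p^2*r^2 - 336*p^3*r - 210*p^2*r^3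
  | 7 => -s^6*p - 28*s^5*p*r - 114*s^4*p^2 - 210*s^4*p*r^2 - 1456*s^3*p^2*r - 420*s^3*p*r^3
      - 720*s^2*p^3 - 4620*s^2*p^2*r^2 - 105*s^2*p*r^4 - 3808*s*p^3*r - 3360*s*p^2*r^3
      - 272*p^4 - 3360*p^3*r^2 - 210*p^2*r^4
  | _ => 0

/-- The moments of the distribution with cumulants `skewCumulant s p r`. -/
def skewMoment (s p r : R) : ℕ → R
  | 0 => 1
  | 1 => 0
  | 2 => -p
  | 3 => -s*p - 3*p*r
  | 4 => -s^2*p - 6*s*p*r + p^2 - 3*p*r^2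
  | 5 => -s^3*p - 10*s^2*p*r + 2*s*p^2 - 15*s*p*r^2 + 10*p^2*r
  | 6 => -s^4*p - 15*s^3*p*r + 3*s^2*p^2 - 45*s^2*p*r^2 + 30*s*p^2*r - 15*s*p*r^3 - p^3
      + 45*p^2*r^2
  | 7 => -s^5*p - 21*s^4*p*r + 4*s^3*p^2 - 105*s^3*p*r^2 + 63*s^2*p^2*r - 105*s^2*p*r^3
      - 3*s*p^3 + 210*s*p^2*r^2 - 21*p^3*r + 105*p^2*r^3
  | 8 => -s^6*p - 28*s^5*p*r + 5*s^4*p^2 - 210*s^4*p*r^2 + 112*s^3*p^2*r - 420*s^3*p*r^3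
      - 6*s^2*p^3 + 630*s^2*p^2*r^2 - 105*s^2*p*r^4 - 84*s*p^3*r + 840*s*p^2*r^3 + p^4
      - 210*p^3*r^2 + 105*p^2*r^4
  | _ => 0

/-- The cumulants of a mixture of two Gaussians with mean `k1` and variance `k2`. -/
def mixtureCumulant (k1 k2 s p r : R) : ℕ → R
  | 0 => k1
  | 1 => k2
  | n => skewCumulant s p r n

/-- Where p is invertible, this and the next four identities say that each equation prescribes
exactly the parametrized value of its last cumulant. -/
theorem eqFour_skew (s p r k4 : R) :
    eqFour (skewCumulant s p r 2) k4 s p = 3 * p * (k4 - skewCumulant s p r 3) := by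
  simp only [eqFour, skewCumulant]; ring

theorem eqFive_skew (s p r k5 : R) :
    eqFive (skewCumulant s p r 2) k5 s p = 3 * p * (k5 - skewCumulant s p r 4) := by
  simp only [eqFive, skewCumulant]; ring

/-- The parameter k₂ is free: the k₂-terms of the equation add up to -45·k₂·p times the
quartic-cumulant equation, which vanishes here. -/
theorem eqSix_skew (k2 s p r k6 : R) :
    eqSix k2 (skewCumulant s p r 2) (skewCumulant s p r 3) k6 s p =
      -9 * p^2 * (k6 - skewCumulant s p r 5) := by
  simp only [eqSix, skewCumulant]; ring

theorem eqSeven_skew (k2 s p r k7 : R) :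
    eqSeven k2 (skewCumulant s p r 2) (skewCumulant s p r 3) (skewCumulant s p r 4) k7 s p =
      9 * p^2 * (k7 - skewCumulant s p r 6) := by
  simp only [eqSeven, skewCumulant]; ring

theorem eqEight_skew (k2 s p r k8 : R) :
    eqEight k2 (skewCumulant s p r 2) (skewCumulant s p r 3) (skewCumulant s p r 4)
      (skewCumulant s p r 5) k8 s p = 27 * p^3 * (k8 - skewCumulant s p r 7) := by
  simp only [eqEight, skewCumulant]; ring

end Parametrization

/-- The cumulant generating function with cumulants `κ 0, κ 1, …`. -/
noncomputable def logSeries (κ : ℕ → ℂ) : PowerSeries ℂ :=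
  PowerSeries.mk fun n => if n = 0 then 0 else κ (n - 1) / (Nat.factorial n : ℂ)

theorem constantCoeff_logSeries (κ : ℕ → ℂ) : PowerSeries.constantCoeff (logSeries κ) = 0 := by
  rw [← PowerSeries.coeff_zero_eq_constantCoeff_apply, logSeries, PowerSeries.coeff_mk, if_pos rfl]

theorem coeff_succ_logSeries (κ : ℕ → ℂ) (n : ℕ) :
    PowerSeries.coeff (n + 1) (logSeries κ) = κ n / (Nat.factorial (n + 1) : ℂ) := by
  simp [logSeries]

/-- A solution of the moment recursion gives the coefficients of `exp(K)`. -/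
theorem coeff_expSeries_eq_of_recursion {K : PowerSeries ℂ}
    (hK : PowerSeries.constantCoeff K = 0) {m : ℕ → ℂ} {N : ℕ} (h0 : m 0 = 1)
    (h : ∀ n < N, m (n + 1) / (Nat.factorial (n + 1) : ℂ) * (n + 1) =
      ∑ j ∈ Finset.range (n + 1), m (n - j) / (Nat.factorial (n - j) : ℂ) *
        (PowerSeries.coeff (j + 1) K * (j + 1))) :
    ∀ n ≤ N, PowerSeries.coeff n (expSeries K) = m n / (Nat.factorial n : ℂ) := by
  intro n
  induction n using Nat.strong_induction_on with
  | _ n ih =>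
    intro hn
    cases n with
    | zero => simpa [h0] using constantCoeff_expSeries hK
    | succ n =>
      refine mul_right_cancel₀ (Nat.cast_add_one_ne_zero n) ?_
      rw [coeff_succ_expSeries hK, h n hn]
      refine Finset.sum_congr rfl fun j _ => ?_
      rw [ih (n - j) (by omega) (by omega)]

theorem coeff_expSeries_logSeries_skew (s p r : ℂ) : ∀ n ≤ 8,
    PowerSeries.coeff n (expSeries (logSeries (mixtureCumulant 0 (-p) s p r))) =
      skewMoment s p r n / (Nat.factorial n : ℂ) := by
  refine coeff_expSeries_eq_of_recursion (constantCoeff_logSeries _) rfl fun n hn => ?_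
  simp only [coeff_succ_logSeries]
  interval_cases n <;>
    simp only [Finset.sum_range_succ, Finset.sum_range_zero, skewMoment, mixtureCumulant,
      skewCumulant, Nat.factorial, Nat.reduceSub, Nat.reduceAdd] <;>
    push_cast <;> ring

/-- The moments of a Gaussian with mean `μ` and variance `v`. -/
noncomputable def gaussianMoment (μ v : ℂ) : ℕ → ℂ
  | 0 => 1
  | 1 => μ
  | 2 => μ^2 + v
  | 3 => μ^3 + 3*μ*v
  | 4 => μ^4 + 6*μ^2*v + 3*v^2
  | 5 => μ^5 + 10*μ^3*v + 15*μ*v^2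
  | 6 => μ^6 + 15*μ^4*v + 45*μ^2*v^2 + 15*v^3
  | 7 => μ^7 + 21*μ^5*v + 105*μ^3*v^2 + 105*μ*v^3
  | 8 => μ^8 + 28*μ^6*v + 210*μ^4*v^2 + 420*μ^2*v^3 + 105*v^4
  | _ => 0

theorem coeff_expSeries_gaussianLog (μ v : ℂ) : ∀ n ≤ 8,
    PowerSeries.coeff n (expSeries (gaussianLog μ v)) =
      gaussianMoment μ v n / (Nat.factorial n : ℂ) := by
  refine coeff_expSeries_eq_of_recursion (constantCoeff_gaussianLog _ _) rfl fun n hn => ?_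
  have hc : ∀ j, PowerSeries.coeff (j + 1) (gaussianLog μ v) =
      if j = 0 then μ else if j = 1 then v / 2 else 0 := by
    intro j
    rw [gaussianLog]
    rcases j with _ | _ | j <;> simp [PowerSeries.coeff_C_mul, PowerSeries.coeff_X_pow]
  simp only [hc]
  interval_cases n <;>
    norm_num [Finset.sum_range_succ, gaussianMoment, Nat.factorial] <;> ring

/-- The factor a - b clears the denominator of the weights, so the identity is polynomial and also
holds for a = b. -/
theorem skewMoment_eq (a b r : ℂ) : ∀ n ≤ 8,
    (a - b) * skewMoment (a + b) (a * b) r n =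
      -b * gaussianMoment a (r * a) n + a * gaussianMoment b (r * b) n := by
  intro n hn
  interval_cases n <;> simp only [skewMoment, gaussianMoment] <;> ring

theorem gaussianLog_add (μ v μ' v' : ℂ) :
    gaussianLog (μ + μ') (v + v') = gaussianLog μ v + gaussianLog μ' v' := by
  simp only [gaussianLog, map_add, add_div]; ring

/-- A mixture of two Gaussians with distinct means has the cumulants `mixtureCumulant`,
up to order 8. -/
theorem coeff_expSeries_mixture (m c a b r : ℂ) (n : ℕ) (hn : n ≤ 8) :
    (a - b) * PowerSeries.coeff n
        (expSeries (logSeries (mixtureCumulant m (c - a * b) (a + b) (a * b) r))) =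
      -b * PowerSeries.coeff n (expSeries (gaussianLog (m + a) (c + r * a))) +
        a * PowerSeries.coeff n (expSeries (gaussianLog (m + b) (c + r * b))) := by
  have hg := constantCoeff_gaussianLog
  have hl := constantCoeff_logSeries
  -- Adding the log of a Gaussian with mean m and variance c changes only the first two cumulants,
  -- so the mixture reduces to the centred case times a common Gaussian factor.
  have hsplit : ∀ k ≤ 8, PowerSeries.coeff k
      (logSeries (mixtureCumulant m (c - a * b) (a + b) (a * b) r)) =
      PowerSeries.coeff k (gaussianLog m c +
        logSeries (mixtureCumulant 0 (-(a * b)) (a + b) (a * b) r)) := by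
    intro k _
    rcases k with _ | _ | _ | k
    · simp [hg, hl]
    · simp [gaussianLog, logSeries, mixtureCumulant, PowerSeries.coeff_X_pow]
    · simp [gaussianLog, logSeries, mixtureCumulant, PowerSeries.coeff_X_pow]
      ring
    · simp [gaussianLog, logSeries, mixtureCumulant, PowerSeries.coeff_X_pow]
  rw [coeff_expSeries_congr (hl _) (by simp [hg, hl]) hsplit n hn, gaussianLog_add, gaussianLog_add,
    expSeries_add (hg _ _) (hl _), expSeries_add (hg _ _) (hg _ _), expSeries_add (hg _ _) (hg _ _)]
  simp only [PowerSeries.coeff_mul, Finset.mul_sum]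
  rw [← Finset.sum_add_distrib]
  refine Finset.sum_congr rfl fun x hx => ?_
  have hx' := Finset.HasAntidiagonal.mem_antidiagonal.mp hx
  rw [coeff_expSeries_logSeries_skew _ _ _ _ (by omega),
    coeff_expSeries_gaussianLog a (r * a) x.2 (by omega),
    coeff_expSeries_gaussianLog b (r * b) x.2 (by omega)]
  have := skewMoment_eq a b r x.2 (by omega)
  linear_combination
    PowerSeries.coeff x.1 (expSeries (gaussianLog m c)) / (Nat.factorial x.2 : ℂ) * this

/-! ### Projective closures, cones and homogenization -/

theorem eval_smul_of_isHomogeneous {N : ℕ} {P : MvPolynomial (Fin N) ℂ} {e : ℕ}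
    (hP : P.IsHomogeneous e) (c : ℂ) (v : Fin N → ℂ) : eval (c • v) P = c ^ e * eval v P := by
  rw [eval_eq', eval_eq', Finset.mul_sum]
  refine Finset.sum_congr rfl fun m hm => ?_
  have hdeg : ∑ i, m i = e := by
    rw [← Finsupp.degree_eq_sum, Finsupp.degree_eq_weight_one]
    exact hP (mem_support_iff.mp hm)
  simp only [Pi.smul_apply, smul_eq_mul, mul_pow, Finset.prod_mul_distrib,
    Finset.prod_pow_eq_pow_sum, hdeg]
  ring

theorem eval_smul_eq_sum_homogeneousComponent {N : ℕ} (P : MvPolynomial (Fin N) ℂ) (c : ℂ)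
    (v : Fin N → ℂ) :
    eval (c • v) P =
      ∑ e ∈ Finset.range (P.totalDegree + 1), c ^ e * eval v (homogeneousComponent e P) := by
  conv_lhs => rw [← sum_homogeneousComponent P, map_sum]
  exact Finset.sum_congr rfl fun e _ =>
    eval_smul_of_isHomogeneous (homogeneousComponent_isHomogeneous e P) c v

/-- A polynomial vanishing on the cone over a set vanishes on the cone over its closure. -/
theorem eval_smul_rep_eq_zero_of_mem_projectiveClosure {N : ℕ} {S : Set (ℙ ℂ (Fin N → ℂ))}
    {P : MvPolynomial (Fin N) ℂ} (h : ∀ y ∈ S, ∀ c : ℂ, eval (c • y.rep) P = 0)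
    {x : ℙ ℂ (Fin N → ℂ)} (hx : x ∈ projectiveClosure S) (c : ℂ) : eval (c • x.rep) P = 0 := by
  rw [eval_smul_eq_sum_homogeneousComponent]
  refine Finset.sum_eq_zero fun e he => ?_
  rw [hx (homogeneousComponent e P) e (homogeneousComponent_isHomogeneous e P), mul_zero]
  intro y hy
  -- Along the line through `y.rep`, P is a polynomial in the scalar whose coefficients are the
  -- values of the homogeneous components; it vanishes identically, so each component vanishes.
  let q : Polynomial ℂ := ∑ e ∈ Finset.range (P.totalDegree + 1),
    Polynomial.monomial e (eval y.rep (homogeneousComponent e P))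
  have hq : q = 0 := by
    refine Polynomial.funext fun t => ?_
    have := h y hy t
    rw [eval_smul_eq_sum_homogeneousComponent] at this
    simp only [q, Polynomial.eval_finsetSum, Polynomial.eval_monomial, Polynomial.eval_zero]
    rw [← this]
    exact Finset.sum_congr rfl fun _ _ => mul_comm _ _
  have := congrArg (fun f => Polynomial.coeff f e) hq
  simpa [q, Polynomial.finsetSum_coeff, Polynomial.coeff_monomial, Finset.mem_range.mp he]
    using this

theorem subset_projectiveClosure {N : ℕ} (S : Set (ℙ ℂ (Fin N → ℂ))) :
    S ⊆ projectiveClosure S := fun _ hx _ _ _ h => h _ hx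

/-- The translate of a polynomial by a vector. -/
theorem exists_translate {N : ℕ} (P : MvPolynomial (Fin N) ℂ) (v : Fin N → ℂ) :
    ∃ Q : MvPolynomial (Fin N) ℂ, ∀ w, eval w Q = eval (v + w) P := by
  refine ⟨aeval (fun i => C (v i) + X i) P, fun w => ?_⟩
  rw [← coe_aeval_eq_eval, ← coe_aeval_eq_eval, RingHom.coe_coe, RingHom.coe_coe,
    ← AlgHom.comp_apply]
  congr 1
  ext i
  simp

theorem exists_smul_eq_rep_mk {N : ℕ} (v : Fin N → ℂ) (hv : v ≠ 0) :
    ∃ a : ℂ, a ≠ 0 ∧ (Projectivization.mk ℂ v hv).rep = a • v := by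
  obtain ⟨a, ha⟩ := Projectivization.exists_smul_eq_mk_rep ℂ v hv
  exact ⟨a, a.ne_zero, ha.symm⟩

/-- A polynomial vanishing on all linear combinations of two Gaussian moment vectors vanishes
on the cone over the secant variety. -/
theorem eval_smul_rep_eq_zero_of_mem_secantVariety {d : ℕ} {P : MvPolynomial (Fin (d + 1)) ℂ}
    (h : ∀ c₁ c₂ μ₁ v₁ μ₂ v₂ : ℂ,
      eval (c₁ • momentVector d (expSeries (gaussianLog μ₁ v₁)) +
        c₂ • momentVector d (expSeries (gaussianLog μ₂ v₂))) P = 0)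
    {x : ℙ ℂ (Fin (d + 1) → ℂ)} (hx : x ∈ secantVariety 2 (gaussianMomentVariety d)) (c : ℂ) :
    eval (c • x.rep) P = 0 := by
  have hclos : ∀ Q : MvPolynomial (Fin (d + 1)) ℂ,
      (∀ c μ v : ℂ, eval (c • momentVector d (expSeries (gaussianLog μ v))) Q = 0) →
      ∀ y ∈ gaussianMomentVariety d, ∀ c : ℂ, eval (c • y.rep) Q = 0 := by
    intro Q hQ y hy c
    refine eval_smul_rep_eq_zero_of_mem_projectiveClosure ?_ hy c
    rintro _ ⟨μ, v, rfl⟩ c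
    obtain ⟨a, -, ha⟩ := exists_smul_eq_rep_mk _
      (momentVector_expSeries_ne_zero d (constantCoeff_gaussianLog μ v))
    rw [expPoint, ha, smul_smul]
    exact hQ _ _ _
  -- The closure is taken in one argument at a time: with the other summand fixed, a translate of P
  -- is a polynomial to which `hclos` applies.
  have h1 : ∀ c₁ μ₁ v₁ : ℂ, ∀ y ∈ gaussianMomentVariety d, ∀ c : ℂ,
      eval (c₁ • momentVector d (expSeries (gaussianLog μ₁ v₁)) + c • y.rep) P = 0 := by
    intro c₁ μ₁ v₁ y hy c
    obtain ⟨Q, hQ⟩ := exists_translate P (c₁ • momentVector d (expSeries (gaussianLog μ₁ v₁)))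
    rw [← hQ]
    exact hclos Q (fun c μ v => by rw [hQ]; exact h _ _ _ _ _ _) y hy c
  have h2 : ∀ y₁ ∈ gaussianMomentVariety d, ∀ y₂ ∈ gaussianMomentVariety d, ∀ c₁ c₂ : ℂ,
      eval (c₁ • y₁.rep + c₂ • y₂.rep) P = 0 := by
    intro y₁ hy₁ y₂ hy₂ c₁ c₂
    obtain ⟨Q, hQ⟩ := exists_translate P (c₂ • y₂.rep)
    rw [add_comm (c₁ • y₁.rep), ← hQ]
    refine hclos Q (fun c μ v => ?_) y₁ hy₁ c₁
    rw [hQ, add_comm (c₂ • y₂.rep)]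
    exact h1 _ _ _ _ hy₂ _
  refine eval_smul_rep_eq_zero_of_mem_projectiveClosure ?_ hx c
  rintro z ⟨y, hy, hz⟩ c
  have hzr : z.rep ∈ ⨆ i, (y i).submodule := hz (by
    rw [Projectivization.submodule_eq]; exact Submodule.mem_span_singleton_self _)
  have hsup : (⨆ i, (y i).submodule) = (y 0).submodule ⊔ (y 1).submodule :=
    le_antisymm (iSup_le fun i => by fin_cases i <;> simp)
      (sup_le (le_iSup (fun i => (y i).submodule) 0) (le_iSup (fun i => (y i).submodule) 1))
  rw [hsup, Projectivization.submodule_eq, Projectivization.submodule_eq,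
    Submodule.mem_sup] at hzr
  obtain ⟨u, hu, w, hw, huw⟩ := hzr
  obtain ⟨a, rfl⟩ := Submodule.mem_span_singleton.mp hu
  obtain ⟨b, rfl⟩ := Submodule.mem_span_singleton.mp hw
  rw [← huw, smul_add, smul_smul, smul_smul]
  exact h2 _ (hy 0) _ (hy 1) _ _

/-- Homogenisation: `F` evaluated at `v / v₀` times a power of `v₀` is a polynomial in `v`
vanishing for `v₀ = 0`. -/
theorem exists_homogenization {d : ℕ} (f : MvPolynomial (Fin (d + 1)) ℂ) :
    ∃ (P : MvPolynomial (Fin (d + 1)) ℂ), (∀ v : Fin (d + 1) → ℂ, v 0 = 0 → eval v P = 0) ∧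
      ∃ n : ℕ, ∀ v : Fin (d + 1) → ℂ, v 0 ≠ 0 →
        eval v P = v 0 ^ n * eval ((v 0)⁻¹ • v) f := by
  suffices H : ∃ (P : MvPolynomial (Fin (d + 1)) ℂ) (n : ℕ), ∀ v : Fin (d + 1) → ℂ, v 0 ≠ 0 →
      eval v P = v 0 ^ n * eval ((v 0)⁻¹ • v) f by
    obtain ⟨P, n, h⟩ := H
    -- The extra factor X₀ forces vanishing on the hyperplane at infinity.
    refine ⟨X 0 * P, fun v hv => by simp [hv], n + 1, fun v hv => ?_⟩
    rw [map_mul, eval_X, h v hv]; ring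
  induction f using MvPolynomial.induction_on with
  | C a => exact ⟨C a, 0, fun v _ => by simp⟩
  | add p q hp hq =>
    obtain ⟨P, m, hP⟩ := hp
    obtain ⟨Q, n, hQ⟩ := hq
    refine ⟨X 0 ^ n * P + X 0 ^ m * Q, m + n, fun v hv => ?_⟩
    simp only [map_add, map_mul, map_pow, eval_X, hP v hv, hQ v hv]
    ring
  | mul_X p i hp =>
    obtain ⟨P, m, hP⟩ := hp
    refine ⟨P * X i, m + 1, fun v hv => ?_⟩
    simp only [map_mul, eval_X, hP v hv, Pi.smul_apply, smul_eq_mul]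
    rw [pow_succ]
    have := mul_inv_cancel₀ hv
    linear_combination -(v 0 ^ m * eval ((v 0)⁻¹ • v) p * v i) * this

/-! ### The secant ideal as the kernel of the parametrization -/

theorem map_mixtureCumulant {R S : Type*} [CommRing R] [CommRing S] (f : R →+* S)
    (k1 k2 s p r : R) (n : ℕ) :
    f (mixtureCumulant k1 k2 s p r n) = mixtureCumulant (f k1) (f k2) (f s) (f p) (f r) n := by
  rcases n with _ | _ | _ | _ | _ | _ | _ | _ | n <;>
    simp [mixtureCumulant, skewCumulant, map_ofNat f]

/-- The parametrization of the cumulants of Gaussian mixtures, on coordinate rings. -/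
noncomputable def mixtureMap (d : ℕ) : MvPolynomial (Fin d) ℂ →ₐ[ℂ] MvPolynomial (Fin 5) ℂ :=
  aeval fun i => mixtureCumulant (X 0) (X 1) (X 2) (X 3) (X 4) (i : ℕ)

/-- The first `d` cumulants of a Gaussian mixture. -/
def mixturePoint (d : ℕ) (x : Fin 5 → ℂ) : Fin d → ℂ :=
  fun i => mixtureCumulant (x 0) (x 1) (x 2) (x 3) (x 4) (i : ℕ)

theorem eval_mixtureMap (d : ℕ) (x : Fin 5 → ℂ) (F : MvPolynomial (Fin d) ℂ) :
    eval x (mixtureMap d F) = eval (mixturePoint d x) F := by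
  rw [← coe_aeval_eq_eval, ← coe_aeval_eq_eval, RingHom.coe_coe, RingHom.coe_coe,
    ← AlgHom.comp_apply]
  congr 1
  ext i
  simp only [mixtureMap, AlgHom.comp_apply, aeval_X, mixturePoint]
  simpa using map_mixtureCumulant (aeval x : MvPolynomial (Fin 5) ℂ →ₐ[ℂ] ℂ).toRingHom
    (X 0) (X 1) (X 2) (X 3) (X 4) i

theorem mem_ker_mixtureMap {d : ℕ} {F : MvPolynomial (Fin d) ℂ} :
    F ∈ RingHom.ker (mixtureMap d) ↔ ∀ x, eval (mixturePoint d x) F = 0 := by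
  rw [RingHom.mem_ker, MvPolynomial.funext_iff]
  simp [eval_mixtureMap]

theorem eq_zero_of_eval_eq_zero_of_ne {n : ℕ} {G h : MvPolynomial (Fin n) ℂ} (hh : h ≠ 0)
    (H : ∀ x, eval x h ≠ 0 → eval x G = 0) : G = 0 := by
  have : h * G = 0 := by
    refine MvPolynomial.funext fun x => ?_
    rw [map_mul, map_zero]
    by_cases hx : eval x h = 0
    · rw [hx, zero_mul]
    · rw [H x hx, mul_zero]
  exact (mul_eq_zero.mp this).resolve_left hh

theorem coeff_cumulantSeries_eq_logSeries {d : ℕ} (κ : ℕ → ℂ) :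
    ∀ n ≤ d, PowerSeries.coeff n (cumulantSeries d fun i => κ i) =
      PowerSeries.coeff n (logSeries κ) := by
  intro n hn
  cases n with
  | zero => simp [constantCoeff_cumulantSeries, constantCoeff_logSeries]
  | succ n => rw [coeff_cumulantSeries d (fun i => κ i) ⟨n, hn⟩, coeff_succ_logSeries]

theorem momentVector_mixture {d : ℕ} (hd : d ≤ 8) (m c a b r : ℂ) :
    (a - b) • momentVector d (expSeries (cumulantSeries d
        (mixturePoint d ![m, c - a * b, a + b, a * b, r]))) =
      (-b) • momentVector d (expSeries (gaussianLog (m + a) (c + r * a))) +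
        a • momentVector d (expSeries (gaussianLog (m + b) (c + r * b))) := by
  ext i
  have hi : (i : ℕ) ≤ d := Nat.lt_succ_iff.mp i.2
  have h := coeff_expSeries_mixture m c a b r i (hi.trans hd)
  have h2 := coeff_expSeries_congr (constantCoeff_cumulantSeries d _) (constantCoeff_logSeries _)
    (coeff_cumulantSeries_eq_logSeries (d := d)
      (mixtureCumulant m (c - a * b) (a + b) (a * b) r)) i hi
  rw [← h2] at h
  simp only [momentVector, Pi.smul_apply, Pi.add_apply, smul_eq_mul]
  have h3 : (mixturePoint d ![m, c - a * b, a + b, a * b, r]) =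
      fun i : Fin d => mixtureCumulant m (c - a * b) (a + b) (a * b) r i := rfl
  rw [h3]
  linear_combination (Nat.factorial i : ℂ) * h

theorem expPoint_gaussianLog_mem (d : ℕ) (μ v : ℂ) :
    expPoint d (gaussianLog μ v) (constantCoeff_gaussianLog μ v) ∈ gaussianMomentVariety d :=
  subset_projectiveClosure _ ⟨μ, v, rfl⟩

theorem mixturePoint_mem_secantInCumulants {d : ℕ} (hd : d ≤ 8) (m c r : ℂ) {a b : ℂ}
    (hab : a ≠ b) : mixturePoint d ![m, c - a * b, a + b, a * b, r] ∈ secantInCumulants d := by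
  refine subset_projectiveClosure _
    ⟨![expPoint d _ (constantCoeff_gaussianLog (m + a) (c + r * a)),
      expPoint d _ (constantCoeff_gaussianLog (m + b) (c + r * b))], fun i => ?_, ?_⟩
  · fin_cases i
    · exact expPoint_gaussianLog_mem d _ _
    · exact expPoint_gaussianLog_mem d _ _
  · have h := momentVector_mixture hd m c a b r
    have hab' : a - b ≠ 0 := sub_ne_zero.mpr hab
    rw [← eq_inv_smul_iff₀ hab'] at h
    rw [expPoint, Projectivization.submodule_mk, Submodule.span_singleton_le_iff_mem, h]
    refine Submodule.smul_mem _ _ (Submodule.add_mem _ ?_ ?_)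
    · refine Submodule.smul_mem _ _ (Submodule.mem_iSup_of_mem 0 ?_)
      simp only [expPoint, Matrix.cons_val_zero, Projectivization.submodule_mk]
      exact Submodule.mem_span_singleton_self _
    · refine Submodule.smul_mem _ _ (Submodule.mem_iSup_of_mem 1 ?_)
      simp only [expPoint, Matrix.cons_val_one]
      exact Submodule.mem_span_singleton_self _

/-- Wherever s² ≠ 4p, the parameters come from two distinct a, b, the roots of T² - sT + p, so the
image point lies on a secant line; this suffices by density. -/
theorem secantIdeal_le_ker {d : ℕ} (hd : d ≤ 8) :
    secantIdeal d ≤ RingHom.ker (mixtureMap d) := by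
  intro F hF
  rw [RingHom.mem_ker]
  have hne : (X 2 ^ 2 - 4 * X 3 : MvPolynomial (Fin 5) ℂ) ≠ 0 := by
    intro h
    have := congrArg (eval ![0, 0, 1, 0, 0]) h
    simp at this
  refine eq_zero_of_eval_eq_zero_of_ne hne fun x hx => ?_
  rw [eval_mixtureMap]
  obtain ⟨δ, hδ⟩ := IsAlgClosed.exists_pow_nat_eq (x 2 ^ 2 - 4 * x 3) two_pos
  have hδ0 : δ ≠ 0 := by
    rintro rfl
    apply hx
    simp [← hδ]
  -- Here δ = a - b, and c is taken to be k₂ + ab so that c - ab = k₂.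
  have hx' : x = ![x 0, (x 1 + (x 2 + δ) / 2 * ((x 2 - δ) / 2)) - (x 2 + δ) / 2 * ((x 2 - δ) / 2),
      (x 2 + δ) / 2 + (x 2 - δ) / 2, (x 2 + δ) / 2 * ((x 2 - δ) / 2), x 4] := by
    ext i
    fin_cases i
    · simp
    · simp
    · simp; ring
    · simp; linear_combination hδ / 4
    · simp
  have hab : (x 2 + δ) / 2 ≠ (x 2 - δ) / 2 := by
    intro h
    apply hδ0
    linear_combination h
  have := hF _ (mixturePoint_mem_secantInCumulants hd (x 0)
    (x 1 + (x 2 + δ) / 2 * ((x 2 - δ) / 2)) (x 4) hab)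
  rw [← hx'] at this
  simpa using this

theorem continuous_momentVector_gaussian {d : ℕ} (hd : d ≤ 8) (v : ℂ) :
    Continuous fun μ => momentVector d (expSeries (gaussianLog μ v)) := by
  refine continuous_pi fun i => ?_
  have hi : (i : ℕ) ≤ 8 := (Nat.lt_succ_iff.mp i.2).trans hd
  simp only [momentVector, coeff_expSeries_gaussianLog _ _ _ hi]
  generalize (i : ℕ) = n at hi
  interval_cases n <;> simp only [gaussianMoment] <;> fun_prop

/-- Rewritten in moments and homogenized, F becomes a polynomial P on the cone. It suffices that P
vanishes on combinations of two Gaussian moment vectors: those with distinct means are mixtures up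
to scale or lie at infinity, and equal means follow by continuity. -/
theorem ker_le_secantIdeal {d : ℕ} (hd : d ≤ 8) :
    RingHom.ker (mixtureMap d) ≤ secantIdeal d := by
  intro F hF κ hκ
  rw [mem_ker_mixtureMap] at hF
  choose c hc using exists_cumulant_polynomial d
  obtain ⟨P, hP0, n, hP⟩ := exists_homogenization (aeval c F)
  have heval : ∀ κ : Fin d → ℂ,
      eval (momentVector d (expSeries (cumulantSeries d κ))) (aeval c F) = eval κ F := by
    intro κ
    rw [← coe_aeval_eq_eval, ← coe_aeval_eq_eval, RingHom.coe_coe, RingHom.coe_coe,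
      ← AlgHom.comp_apply]
    congr 1
    ext i
    simpa using hc i κ
  have hmv0 : ∀ {K : PowerSeries ℂ}, PowerSeries.constantCoeff K = 0 →
      momentVector d (expSeries K) 0 = 1 := momentVector_expSeries_zero d
  have generic : ∀ c₁ c₂ μ₁ v₁ μ₂ v₂ : ℂ, μ₁ ≠ μ₂ →
      eval (c₁ • momentVector d (expSeries (gaussianLog μ₁ v₁)) +
        c₂ • momentVector d (expSeries (gaussianLog μ₂ v₂))) P = 0 := by
    intro c₁ c₂ μ₁ v₁ μ₂ v₂ hμ
    set v := c₁ • momentVector d (expSeries (gaussianLog μ₁ v₁)) +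
        c₂ • momentVector d (expSeries (gaussianLog μ₂ v₂)) with hv
    have hv0 : v 0 = c₁ + c₂ := by
      simp [hv, hmv0 (constantCoeff_gaussianLog _ _)]
    by_cases hw : c₁ + c₂ = 0
    · exact hP0 _ (by rw [hv0, hw])
    rw [hP v (by rwa [hv0]), hv0]
    have hμ' : μ₁ - μ₂ ≠ 0 := sub_ne_zero.mpr hμ
    -- The data are read off from the normalized mixture: m is its mean, a = μ₁ - m, b = μ₂ - m, r
    -- is the slope of variance against mean, and c = v₁ - ra. The weights -b/(a-b) and a/(a-b) are
    -- then c₁/(c₁+c₂) and c₂/(c₁+c₂).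
    have hmix := momentVector_mixture hd ((c₁ * μ₁ + c₂ * μ₂) / (c₁ + c₂))
      (v₁ - (v₁ - v₂) / (μ₁ - μ₂) * (c₂ * (μ₁ - μ₂) / (c₁ + c₂))) (c₂ * (μ₁ - μ₂) / (c₁ + c₂))
      (-(c₁ * (μ₁ - μ₂) / (c₁ + c₂))) ((v₁ - v₂) / (μ₁ - μ₂))
    have e1 : (c₁ * μ₁ + c₂ * μ₂) / (c₁ + c₂) + c₂ * (μ₁ - μ₂) / (c₁ + c₂) = μ₁ := by
      field_simp; ring
    have e2 : (c₁ * μ₁ + c₂ * μ₂) / (c₁ + c₂) + -(c₁ * (μ₁ - μ₂) / (c₁ + c₂)) = μ₂ := by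
      field_simp; ring
    have e3 : v₁ - (v₁ - v₂) / (μ₁ - μ₂) * (c₂ * (μ₁ - μ₂) / (c₁ + c₂)) +
        (v₁ - v₂) / (μ₁ - μ₂) * (c₂ * (μ₁ - μ₂) / (c₁ + c₂)) = v₁ := by ring
    have e4 : v₁ - (v₁ - v₂) / (μ₁ - μ₂) * (c₂ * (μ₁ - μ₂) / (c₁ + c₂)) +
        (v₁ - v₂) / (μ₁ - μ₂) * -(c₁ * (μ₁ - μ₂) / (c₁ + c₂)) = v₂ := by
      field_simp; ring
    have e5 : c₂ * (μ₁ - μ₂) / (c₁ + c₂) - -(c₁ * (μ₁ - μ₂) / (c₁ + c₂)) = μ₁ - μ₂ := by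
      field_simp; ring
    rw [e1, e2, e3, e4, e5] at hmix
    have hscale : (c₁ + c₂)⁻¹ • v = momentVector d (expSeries (cumulantSeries d (mixturePoint d
        ![(c₁ * μ₁ + c₂ * μ₂) / (c₁ + c₂),
          v₁ - (v₁ - v₂) / (μ₁ - μ₂) * (c₂ * (μ₁ - μ₂) / (c₁ + c₂)) -
            c₂ * (μ₁ - μ₂) / (c₁ + c₂) * -(c₁ * (μ₁ - μ₂) / (c₁ + c₂)),
          c₂ * (μ₁ - μ₂) / (c₁ + c₂) + -(c₁ * (μ₁ - μ₂) / (c₁ + c₂)),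
          c₂ * (μ₁ - μ₂) / (c₁ + c₂) * -(c₁ * (μ₁ - μ₂) / (c₁ + c₂)),
          (v₁ - v₂) / (μ₁ - μ₂)]))) := by
      rw [inv_smul_eq_iff₀ hw]
      ext i
      have h := congrFun hmix i
      simp only [Pi.smul_apply, Pi.add_apply, smul_eq_mul] at h
      simp only [hv, Pi.smul_apply, Pi.add_apply, smul_eq_mul]
      refine mul_left_cancel₀ hμ' ?_
      rw [mul_left_comm, h]
      field_simp
    rw [hscale, heval, hF, mul_zero]
  have all : ∀ c₁ c₂ μ₁ v₁ μ₂ v₂ : ℂ,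
      eval (c₁ • momentVector d (expSeries (gaussianLog μ₁ v₁)) +
        c₂ • momentVector d (expSeries (gaussianLog μ₂ v₂))) P = 0 := by
    intro c₁ c₂ μ₁ v₁ μ₂ v₂
    have hcont : Continuous fun μ => eval (c₁ • momentVector d (expSeries (gaussianLog μ v₁)) +
        c₂ • momentVector d (expSeries (gaussianLog μ₂ v₂))) P :=
      (MvPolynomial.continuous_eval P).comp
        (((continuous_momentVector_gaussian hd v₁).const_smul c₁).add continuous_const)
    -- Moving μ₁ off μ₂ reaches the generic case on a dense set.
    exact congrFun (hcont.ext_on (dense_compl_singleton μ₂) continuous_const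
      fun μ hμ => generic c₁ c₂ μ v₁ μ₂ v₂ hμ) μ₁
  have hK := constantCoeff_cumulantSeries d κ
  obtain ⟨a, ha, har⟩ := exists_smul_eq_rep_mk _ (momentVector_expSeries_ne_zero d hK)
  -- The scalar a⁻¹ turns the chosen representative back into the moment vector with m₀ = 1, where P
  -- agrees with F.
  have h := eval_smul_rep_eq_zero_of_mem_secantVariety all hκ a⁻¹
  rw [expPoint, har, smul_smul, inv_mul_cancel₀ ha, one_smul, hP _ (by simp [hmv0 hK]),
    hmv0 hK, inv_one, one_smul, one_pow, one_mul, heval] at h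
  simpa using h

theorem secantIdeal_eq_ker {d : ℕ} (hd : d ≤ 8) :
    secantIdeal d = RingHom.ker (mixtureMap d) :=
  le_antisymm (secantIdeal_le_ker hd) (ker_le_secantIdeal hd)

/-! ### Elimination with p inverted -/

section MapEquations

variable {R S : Type*} [CommRing R] [CommRing S] (f : R →+* S)

theorem map_eqFour (k3 k4 s p : R) :
    f (eqFour k3 k4 s p) = eqFour (f k3) (f k4) (f s) (f p) := by
  simp [eqFour, map_ofNat f]

theorem map_eqFive (k3 k5 s p : R) :
    f (eqFive k3 k5 s p) = eqFive (f k3) (f k5) (f s) (f p) := by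
  simp [eqFive, map_ofNat f]

theorem map_eqSix (k2 k3 k4 k6 s p : R) :
    f (eqSix k2 k3 k4 k6 s p) = eqSix (f k2) (f k3) (f k4) (f k6) (f s) (f p) := by
  simp [eqSix, map_ofNat f]

theorem map_eqSeven (k2 k3 k4 k5 k7 s p : R) :
    f (eqSeven k2 k3 k4 k5 k7 s p) =
      eqSeven (f k2) (f k3) (f k4) (f k5) (f k7) (f s) (f p) := by
  simp [eqSeven, map_ofNat f]

theorem map_eqEight (k2 k3 k4 k5 k6 k8 s p : R) :
    f (eqEight k2 k3 k4 k5 k6 k8 s p) =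
      eqEight (f k2) (f k3) (f k4) (f k5) (f k6) (f k8) (f s) (f p) := by
  simp [eqEight, map_ofNat f]

end MapEquations

/-- The elements of an algebra that lie in a subalgebra modulo an ideal, after multiplication by
a power of `p`. -/
def subalgebraUpTo {B : Type*} [CommRing B] [Algebra ℂ B] (T : Subalgebra ℂ B) (p : T)
    (I : Ideal B) : Subalgebra ℂ B where
  carrier := {F | ∃ n : ℕ, ∃ t : T, (p : B) ^ n * F - t ∈ I}
  mul_mem' := by
    rintro a b ⟨m, t, ht⟩ ⟨n, u, hu⟩
    refine ⟨m + n, t * u, ?_⟩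
    have h : (p : B) ^ (m + n) * (a * b) - ((t * u : T) : B) =
        ((p : B) ^ n * b) * ((p : B) ^ m * a - t) + t * ((p : B) ^ n * b - u) := by
      push_cast; ring
    rw [h]
    exact I.add_mem (I.mul_mem_left _ ht) (I.mul_mem_left _ hu)
  add_mem' := by
    rintro a b ⟨m, t, ht⟩ ⟨n, u, hu⟩
    refine ⟨m + n, p ^ n * t + p ^ m * u, ?_⟩
    have h : (p : B) ^ (m + n) * (a + b) - ((p ^ n * t + p ^ m * u : T) : B) =
        (p : B) ^ n * ((p : B) ^ m * a - t) + (p : B) ^ m * ((p : B) ^ n * b - u) := by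
      push_cast; ring
    rw [h]
    exact I.add_mem (I.mul_mem_left _ ht) (I.mul_mem_left _ hu)
  algebraMap_mem' c := ⟨0, algebraMap ℂ T c, by simp⟩

theorem le_subalgebraUpTo {B : Type*} [CommRing B] [Algebra ℂ B] (T : Subalgebra ℂ B) (p : T)
    (I : Ideal B) : T ≤ subalgebraUpTo T p I := fun t ht => ⟨0, ⟨t, ht⟩, by simp⟩

theorem mem_subalgebraUpTo_of_linear {B : Type*} [CommRing B] [Algebra ℂ B] {T : Subalgebra ℂ B}
    {p : T} {I : Ideal B} {F H : B} {c : ℂ} (hc : c ≠ 0) {m : ℕ}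
    (h : algebraMap ℂ B c * (p : B) ^ m * F + H ∈ I) (hH : H ∈ subalgebraUpTo T p I) :
    F ∈ subalgebraUpTo T p I := by
  obtain ⟨n, t, ht⟩ := hH
  refine ⟨m + n, -(algebraMap ℂ T c⁻¹ * t), ?_⟩
  have hcc : algebraMap ℂ B c⁻¹ * algebraMap ℂ B c = 1 := by
    rw [← map_mul, inv_mul_cancel₀ hc, map_one]
  have e : (p : B) ^ (m + n) * F - ((-(algebraMap ℂ T c⁻¹ * t) : T) : B) =
      algebraMap ℂ B c⁻¹ * ((p : B) ^ n * (algebraMap ℂ B c * (p : B) ^ m * F + H)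
        - ((p : B) ^ n * H - t)) := by
    push_cast
    linear_combination (-(p : B) ^ (m + n) * F) * hcc
  rw [e]
  exact I.mul_mem_left _ (I.sub_mem (I.mul_mem_left _ h) ht)

section Elimination

variable {d : ℕ}

/-- The point of `ℂ^{d+2}` with coordinates the cumulants of a mixture, `s` and `p`. -/
def systemPoint (d : ℕ) (x : Fin 5 → ℂ) : Fin d ⊕ Fin 2 → ℂ :=
  Sum.elim (mixturePoint d x) ![x 2, x 3]

/-- The subalgebra `ℂ[k₁, k₂, k₃, s, p]`. -/
noncomputable def freeSubalgebra (i₀ i₁ i₂ : Fin d) :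
    Subalgebra ℂ (MvPolynomial (Fin d ⊕ Fin 2) ℂ) :=
  (aeval ![kVar i₀, kVar i₁, kVar i₂, sVar, pVar] : MvPolynomial (Fin 5) ℂ →ₐ[ℂ] _).range

theorem kVar_zero_mem (i₀ i₁ i₂ : Fin d) : kVar i₀ ∈ freeSubalgebra i₀ i₁ i₂ :=
  ⟨X 0, by simp⟩

theorem kVar_one_mem (i₀ i₁ i₂ : Fin d) : kVar i₁ ∈ freeSubalgebra i₀ i₁ i₂ :=
  ⟨X 1, by simp⟩

theorem kVar_two_mem (i₀ i₁ i₂ : Fin d) : kVar i₂ ∈ freeSubalgebra i₀ i₁ i₂ :=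
  ⟨X 2, by simp⟩

theorem sVar_mem (i₀ i₁ i₂ : Fin d) : sVar ∈ freeSubalgebra i₀ i₁ i₂ :=
  ⟨X 3, by simp⟩

theorem pVar_mem (i₀ i₁ i₂ : Fin d) : pVar ∈ freeSubalgebra i₀ i₁ i₂ :=
  ⟨X 4, by simp⟩

/-- The elements of `ℂ[k₁, …, k_d, s, p]` which modulo `I` belong to `ℂ[k₁, k₂, k₃, s, p, p⁻¹]`. -/
noncomputable def reducibleSubalgebra (i₀ i₁ i₂ : Fin d)
    (I : Ideal (MvPolynomial (Fin d ⊕ Fin 2) ℂ)) :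
    Subalgebra ℂ (MvPolynomial (Fin d ⊕ Fin 2) ℂ) :=
  subalgebraUpTo (freeSubalgebra i₀ i₁ i₂) ⟨pVar, pVar_mem i₀ i₁ i₂⟩ I

theorem eval_systemPoint_rename (x : Fin 5 → ℂ) (F : MvPolynomial (Fin d) ℂ) :
    eval (systemPoint d x) (rename Sum.inl F) = eval (mixturePoint d x) F := by
  rw [eval_rename]; rfl

theorem eval_systemPoint_kVar (x : Fin 5 → ℂ) (i : Fin d) :
    eval (systemPoint d x) (kVar i) = mixturePoint d x i := by
  simp [kVar, systemPoint]

theorem eval_systemPoint_sVar (x : Fin 5 → ℂ) :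
    eval (systemPoint d x) sVar = x 2 := by
  simp [sVar, systemPoint]

theorem eval_systemPoint_pVar (x : Fin 5 → ℂ) :
    eval (systemPoint d x) pVar = x 3 := by
  simp [pVar, systemPoint]

/-- Modulo I, a power of p times F is a polynomial G in k₁, k₂, k₃, s, p. If F vanishes on the
parametrized points, so does G, and these points realize all values of the five variables with p ≠
0; hence G = 0. The converse cancels p, which is nonzero on a dense set. -/
theorem mem_ker_mixtureMap_iff_exists_pow {i₀ i₁ i₂ : Fin d} (h₀ : (i₀ : ℕ) = 0)
    (h₁ : (i₁ : ℕ) = 1) (h₂ : (i₂ : ℕ) = 2) {I : Ideal (MvPolynomial (Fin d ⊕ Fin 2) ℂ)}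
    (hI : ∀ x, ∀ g ∈ I, eval (systemPoint d x) g = 0)
    (hS : ∀ i, kVar i ∈ reducibleSubalgebra i₀ i₁ i₂ I) (F : MvPolynomial (Fin d) ℂ) :
    F ∈ RingHom.ker (mixtureMap d) ↔ ∃ n : ℕ, pVar ^ n * rename Sum.inl F ∈ I := by
  constructor
  · intro hF
    rw [mem_ker_mixtureMap] at hF
    have hmem : ∀ F : MvPolynomial (Fin d) ℂ,
        rename Sum.inl F ∈ reducibleSubalgebra i₀ i₁ i₂ I := by
      intro F
      induction F using MvPolynomial.induction_on with
      | C a => rw [rename_C]; exact Subalgebra.algebraMap_mem _ a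
      | add p q hp hq => rw [map_add]; exact Subalgebra.add_mem _ hp hq
      | mul_X p i hp => rw [map_mul, rename_X]; exact Subalgebra.mul_mem _ hp (hS i)
    obtain ⟨n, ⟨_, G, rfl⟩, hG⟩ := hmem F
    have hG0 : G = 0 := by
      refine eq_zero_of_eval_eq_zero_of_ne (X_ne_zero 4) fun y hy => ?_
      rw [eval_X] at hy
      -- The last entry is r, solved from k₃ = -p(s + 3r).
      let x : Fin 5 → ℂ := ![y 0, y 1, y 3, y 4, -(y 2 / y 4 + y 3) / 3]
      have h := hI x _ hG
      have hcomp : eval (systemPoint d x)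
          (aeval ![kVar i₀, kVar i₁, kVar i₂, sVar, pVar] G) = eval y G := by
        rw [← coe_aeval_eq_eval, ← coe_aeval_eq_eval, RingHom.coe_coe, RingHom.coe_coe,
          ← AlgHom.comp_apply]
        congr 1
        ext j
        simp only [AlgHom.comp_apply, aeval_X]
        rw [← RingHom.coe_coe, coe_aeval_eq_eval]
        fin_cases j
        · simp [eval_systemPoint_kVar, mixturePoint, h₀, mixtureCumulant, x]
        · simp [eval_systemPoint_kVar, mixturePoint, h₁, mixtureCumulant, x]
        · simp [eval_systemPoint_kVar, mixturePoint, h₂, mixtureCumulant, skewCumulant, x]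
          field_simp
          ring
        · simp [eval_systemPoint_sVar, x]
        · simp [eval_systemPoint_pVar, x]
      simp only [map_sub, map_mul, eval_systemPoint_rename, hF, mul_zero, zero_sub,
        neg_eq_zero] at h
      rw [← hcomp]
      exact h
    refine ⟨n, ?_⟩
    simpa [hG0] using hG
  · rintro ⟨n, hn⟩
    rw [RingHom.mem_ker]
    refine eq_zero_of_eval_eq_zero_of_ne (X_ne_zero 3) fun x hx => ?_
    have h := hI x _ hn
    rw [map_mul, map_pow, eval_systemPoint_pVar, eval_systemPoint_rename] at h
    rw [eval_mixtureMap]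
    rw [eval_X] at hx
    exact (mul_eq_zero.mp h).resolve_left (pow_ne_zero _ hx)

theorem ker_mixtureMap_eq_eliminate_saturate {i₀ i₁ i₂ : Fin d} (h₀ : (i₀ : ℕ) = 0)
    (h₁ : (i₁ : ℕ) = 1) (h₂ : (i₂ : ℕ) = 2) {I : Ideal (MvPolynomial (Fin d ⊕ Fin 2) ℂ)}
    (hI : ∀ x, ∀ g ∈ I, eval (systemPoint d x) g = 0)
    (hS : ∀ i, kVar i ∈ reducibleSubalgebra i₀ i₁ i₂ I) :
    RingHom.ker (mixtureMap d) = eliminate (saturate I pVar) :=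
  Ideal.ext (mem_ker_mixtureMap_iff_exists_pow h₀ h₁ h₂ hI hS)

theorem mixtureMap_X_two_ne_zero {i : Fin d} (h : (i : ℕ) = 2) : mixtureMap d (X i) ≠ 0 := by
  intro h0
  have := congrArg (eval ![0, 0, 1, 1, 0]) h0
  rw [eval_mixtureMap] at this
  simp [mixturePoint, h, mixtureCumulant, skewCumulant] at this

/-- The equation `eqFour` reads k₃² ≡ p·u modulo I, so k₃²ⁿF ≡ uⁿpⁿF, which lies in I once pⁿF does.
Conversely k₃ can be cancelled because its image in a domain is nonzero. -/
theorem ker_mixtureMap_eq_saturate_eliminate {i₀ i₁ i₂ i₃ : Fin d} (h₀ : (i₀ : ℕ) = 0)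
    (h₁ : (i₁ : ℕ) = 1) (h₂ : (i₂ : ℕ) = 2) {I : Ideal (MvPolynomial (Fin d ⊕ Fin 2) ℂ)}
    (hI : ∀ x, ∀ g ∈ I, eval (systemPoint d x) g = 0)
    (hS : ∀ i, kVar i ∈ reducibleSubalgebra i₀ i₁ i₂ I)
    (h4 : eqFour (kVar i₂) (kVar i₃) sVar pVar ∈ I) :
    RingHom.ker (mixtureMap d) = saturate (eliminate I) (X i₂) := by
  have key := mem_ker_mixtureMap_iff_exists_pow h₀ h₁ h₂ hI hS
  ext F
  constructor
  · intro hF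
    obtain ⟨n, hn⟩ := (key F).mp hF
    refine ⟨2 * n, ?_⟩
    change rename Sum.inl (X i₂ ^ (2 * n) * F) ∈ I
    rw [map_mul, map_pow, rename_X, pow_mul]
    have hsq : (kVar i₂ ^ 2 : MvPolynomial (Fin d ⊕ Fin 2) ℂ) ^ n -
        (pVar * (2 * pVar * sVar ^ 2 + 4 * sVar * kVar i₂ - 6 * pVar ^ 2 - 3 * kVar i₃)) ^ n ∈ I := by
      refine I.mem_of_dvd (sub_dvd_pow_sub_pow _ _ n) ?_
      convert h4 using 1
      simp only [eqFour]; ring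
    have := I.add_mem (I.mul_mem_right (rename Sum.inl F) hsq) (I.mul_mem_left
      ((2 * pVar * sVar ^ 2 + 4 * sVar * kVar i₂ - 6 * pVar ^ 2 - 3 * kVar i₃) ^ n) hn)
    convert this using 1
    rw [mul_pow]
    simp only [kVar]
    ring
  · rintro ⟨n, hn⟩
    have h := (key (X i₂ ^ n * F)).mpr ⟨0, by rw [pow_zero, one_mul]; exact hn⟩
    rw [RingHom.mem_ker, map_mul, map_pow] at h
    exact (mul_eq_zero.mp h).resolve_left (pow_ne_zero _ (mixtureMap_X_two_ne_zero h₂))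

end Elimination

section Solve

variable {B : Type*} [CommRing B] [Algebra ℂ B] {T : Subalgebra ℂ B} {p : T} {I : Ideal B}
  {k2 k3 k4 k5 k6 k7 k8 s : B}

/-- As in the four lemmas that follow, setting the unknown cumulant to 0 leaves the part of the
equation already known to be reducible; what remains is a nonzero constant times a power of p times
the unknown. -/
theorem mem_subalgebraUpTo_of_eqFour (h3 : k3 ∈ subalgebraUpTo T p I)
    (hs : s ∈ subalgebraUpTo T p I) (h : eqFour k3 k4 s (p : B) ∈ I) :
    k4 ∈ subalgebraUpTo T p I := by
  have hp := le_subalgebraUpTo T p I p.2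
  have hH := (eqFour ⟨k3, h3⟩ 0 ⟨s, hs⟩ ⟨p, hp⟩ : subalgebraUpTo T p I).2
  have e := map_eqFour ((subalgebraUpTo T p I).val : subalgebraUpTo T p I →+* B)
    ⟨k3, h3⟩ 0 ⟨s, hs⟩ ⟨p, hp⟩
  simp only [RingHom.coe_coe, Subalgebra.coe_val, ZeroMemClass.coe_zero] at e
  rw [e] at hH
  refine mem_subalgebraUpTo_of_linear (c := 3) (m := 1) (by norm_num) ?_ hH
  convert h using 1
  simp only [eqFour, map_ofNat]; ring

theorem mem_subalgebraUpTo_of_eqFive (h3 : k3 ∈ subalgebraUpTo T p I)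
    (hs : s ∈ subalgebraUpTo T p I) (h : eqFive k3 k5 s (p : B) ∈ I) :
    k5 ∈ subalgebraUpTo T p I := by
  have hp := le_subalgebraUpTo T p I p.2
  have hH := (eqFive ⟨k3, h3⟩ 0 ⟨s, hs⟩ ⟨p, hp⟩ : subalgebraUpTo T p I).2
  have e := map_eqFive ((subalgebraUpTo T p I).val : subalgebraUpTo T p I →+* B)
    ⟨k3, h3⟩ 0 ⟨s, hs⟩ ⟨p, hp⟩
  simp only [RingHom.coe_coe, Subalgebra.coe_val, ZeroMemClass.coe_zero] at e
  rw [e] at hH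
  refine mem_subalgebraUpTo_of_linear (c := 3) (m := 1) (by norm_num) ?_ hH
  convert h using 1
  simp only [eqFive, map_ofNat]; ring

theorem mem_subalgebraUpTo_of_eqSix (h2 : k2 ∈ subalgebraUpTo T p I)
    (h3 : k3 ∈ subalgebraUpTo T p I) (h4 : k4 ∈ subalgebraUpTo T p I)
    (hs : s ∈ subalgebraUpTo T p I) (h : eqSix k2 k3 k4 k6 s (p : B) ∈ I) :
    k6 ∈ subalgebraUpTo T p I := by
  have hp := le_subalgebraUpTo T p I p.2
  have hH := (eqSix ⟨k2, h2⟩ ⟨k3, h3⟩ ⟨k4, h4⟩ 0 ⟨s, hs⟩ ⟨p, hp⟩ : subalgebraUpTo T p I).2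
  have e := map_eqSix ((subalgebraUpTo T p I).val : subalgebraUpTo T p I →+* B)
    ⟨k2, h2⟩ ⟨k3, h3⟩ ⟨k4, h4⟩ 0 ⟨s, hs⟩ ⟨p, hp⟩
  simp only [RingHom.coe_coe, Subalgebra.coe_val, ZeroMemClass.coe_zero] at e
  rw [e] at hH
  refine mem_subalgebraUpTo_of_linear (c := -9) (m := 2) (by norm_num) ?_ hH
  convert h using 1
  simp only [eqSix, map_neg, map_ofNat]; ring

theorem mem_subalgebraUpTo_of_eqSeven (h2 : k2 ∈ subalgebraUpTo T p I)
    (h3 : k3 ∈ subalgebraUpTo T p I) (h4 : k4 ∈ subalgebraUpTo T p I)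
    (h5 : k5 ∈ subalgebraUpTo T p I)
    (hs : s ∈ subalgebraUpTo T p I) (h : eqSeven k2 k3 k4 k5 k7 s (p : B) ∈ I) :
    k7 ∈ subalgebraUpTo T p I := by
  have hp := le_subalgebraUpTo T p I p.2
  have hH := (eqSeven ⟨k2, h2⟩ ⟨k3, h3⟩ ⟨k4, h4⟩ ⟨k5, h5⟩ 0 ⟨s, hs⟩ ⟨p, hp⟩ :
    subalgebraUpTo T p I).2
  have e := map_eqSeven ((subalgebraUpTo T p I).val : subalgebraUpTo T p I →+* B)
    ⟨k2, h2⟩ ⟨k3, h3⟩ ⟨k4, h4⟩ ⟨k5, h5⟩ 0 ⟨s, hs⟩ ⟨p, hp⟩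
  simp only [RingHom.coe_coe, Subalgebra.coe_val, ZeroMemClass.coe_zero] at e
  rw [e] at hH
  refine mem_subalgebraUpTo_of_linear (c := 9) (m := 2) (by norm_num) ?_ hH
  convert h using 1
  simp only [eqSeven, map_ofNat]; ring

theorem mem_subalgebraUpTo_of_eqEight (h2 : k2 ∈ subalgebraUpTo T p I)
    (h3 : k3 ∈ subalgebraUpTo T p I) (h4 : k4 ∈ subalgebraUpTo T p I)
    (h5 : k5 ∈ subalgebraUpTo T p I) (h6 : k6 ∈ subalgebraUpTo T p I)
    (hs : s ∈ subalgebraUpTo T p I) (h : eqEight k2 k3 k4 k5 k6 k8 s (p : B) ∈ I) :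
    k8 ∈ subalgebraUpTo T p I := by
  have hp := le_subalgebraUpTo T p I p.2
  have hH := (eqEight ⟨k2, h2⟩ ⟨k3, h3⟩ ⟨k4, h4⟩ ⟨k5, h5⟩ ⟨k6, h6⟩ 0 ⟨s, hs⟩ ⟨p, hp⟩ :
    subalgebraUpTo T p I).2
  have e := map_eqEight ((subalgebraUpTo T p I).val : subalgebraUpTo T p I →+* B)
    ⟨k2, h2⟩ ⟨k3, h3⟩ ⟨k4, h4⟩ ⟨k5, h5⟩ ⟨k6, h6⟩ 0 ⟨s, hs⟩ ⟨p, hp⟩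
  simp only [RingHom.coe_coe, Subalgebra.coe_val, ZeroMemClass.coe_zero] at e
  rw [e] at hH
  refine mem_subalgebraUpTo_of_linear (c := 27) (m := 3) (by norm_num) ?_ hH
  convert h using 1
  simp only [eqEight, map_ofNat]; ring

end Solve

/-! ### The systems for d = 7 and d = 8 -/

theorem eval_systemPoint_eq_zero_of_mem_systemSeven (x : Fin 5 → ℂ) :
    ∀ g ∈ systemSeven, eval (systemPoint 7 x) g = 0 := by
  have hle : systemSeven ≤ RingHom.ker (eval (systemPoint 7 x)) := by
    refine Ideal.span_le.mpr ?_
    rintro g (rfl | rfl | rfl | rfl) <;> rw [SetLike.mem_coe, RingHom.mem_ker]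
    · rw [map_eqFour]
      simp only [eval_systemPoint_kVar, eval_systemPoint_sVar, eval_systemPoint_pVar]
      exact (eqFour_skew (x 2) (x 3) (x 4) _).trans (by simp [mixturePoint, mixtureCumulant])
    · rw [map_eqFive]
      simp only [eval_systemPoint_kVar, eval_systemPoint_sVar, eval_systemPoint_pVar]
      exact (eqFive_skew (x 2) (x 3) (x 4) _).trans (by simp [mixturePoint, mixtureCumulant])
    · rw [map_eqSix]
      simp only [eval_systemPoint_kVar, eval_systemPoint_sVar, eval_systemPoint_pVar]
      exact (eqSix_skew _ (x 2) (x 3) (x 4) _).trans (by simp [mixturePoint, mixtureCumulant])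
    · rw [map_eqSeven]
      simp only [eval_systemPoint_kVar, eval_systemPoint_sVar, eval_systemPoint_pVar]
      exact (eqSeven_skew _ (x 2) (x 3) (x 4) _).trans (by simp [mixturePoint, mixtureCumulant])
  exact fun g hg => hle hg

theorem eval_systemPoint_eq_zero_of_mem_systemEight (x : Fin 5 → ℂ) :
    ∀ g ∈ systemEight, eval (systemPoint 8 x) g = 0 := by
  have hle : systemEight ≤ RingHom.ker (eval (systemPoint 8 x)) := by
    refine Ideal.span_le.mpr ?_
    rintro g (rfl | rfl | rfl | rfl | rfl) <;> rw [SetLike.mem_coe, RingHom.mem_ker]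
    · rw [map_eqFour]
      simp only [eval_systemPoint_kVar, eval_systemPoint_sVar, eval_systemPoint_pVar]
      exact (eqFour_skew (x 2) (x 3) (x 4) _).trans (by simp [mixturePoint, mixtureCumulant])
    · rw [map_eqFive]
      simp only [eval_systemPoint_kVar, eval_systemPoint_sVar, eval_systemPoint_pVar]
      exact (eqFive_skew (x 2) (x 3) (x 4) _).trans (by simp [mixturePoint, mixtureCumulant])
    · rw [map_eqSix]
      simp only [eval_systemPoint_kVar, eval_systemPoint_sVar, eval_systemPoint_pVar]
      exact (eqSix_skew _ (x 2) (x 3) (x 4) _).trans (by simp [mixturePoint, mixtureCumulant])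
    · rw [map_eqSeven]
      simp only [eval_systemPoint_kVar, eval_systemPoint_sVar, eval_systemPoint_pVar]
      exact (eqSeven_skew _ (x 2) (x 3) (x 4) _).trans (by simp [mixturePoint, mixtureCumulant])
    · rw [map_eqEight]
      simp only [eval_systemPoint_kVar, eval_systemPoint_sVar, eval_systemPoint_pVar]
      exact (eqEight_skew _ (x 2) (x 3) (x 4) _).trans (by simp [mixturePoint, mixtureCumulant])
  exact fun g hg => hle hg

theorem kVar_mem_reducibleSubalgebra_systemSeven (i : Fin 7) :
    kVar i ∈ reducibleSubalgebra 0 1 2 systemSeven := by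
  have hle := le_subalgebraUpTo (freeSubalgebra (0 : Fin 7) 1 2) ⟨pVar, pVar_mem 0 1 2⟩ systemSeven
  have h1 := hle (kVar_zero_mem 0 1 2)
  have h2 := hle (kVar_one_mem 0 1 2)
  have h3 := hle (kVar_two_mem 0 1 2)
  have hs := hle (sVar_mem 0 1 2)
  have h4 := mem_subalgebraUpTo_of_eqFour (k4 := kVar 3) h3 hs (Ideal.subset_span (by simp))
  have h5 := mem_subalgebraUpTo_of_eqFive (k5 := kVar 4) h3 hs (Ideal.subset_span (by simp))
  have h6 := mem_subalgebraUpTo_of_eqSix (k6 := kVar 5) h2 h3 h4 hs (Ideal.subset_span (by simp))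
  have h7 := mem_subalgebraUpTo_of_eqSeven (k7 := kVar 6) h2 h3 h4 h5 hs
    (Ideal.subset_span (by simp))
  fin_cases i <;> assumption

theorem kVar_mem_reducibleSubalgebra_systemEight (i : Fin 8) :
    kVar i ∈ reducibleSubalgebra 0 1 2 systemEight := by
  have hle := le_subalgebraUpTo (freeSubalgebra (0 : Fin 8) 1 2) ⟨pVar, pVar_mem 0 1 2⟩ systemEight
  have h1 := hle (kVar_zero_mem 0 1 2)
  have h2 := hle (kVar_one_mem 0 1 2)
  have h3 := hle (kVar_two_mem 0 1 2)
  have hs := hle (sVar_mem 0 1 2)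
  have h4 := mem_subalgebraUpTo_of_eqFour (k4 := kVar 3) h3 hs (Ideal.subset_span (by simp))
  have h5 := mem_subalgebraUpTo_of_eqFive (k5 := kVar 4) h3 hs (Ideal.subset_span (by simp))
  have h6 := mem_subalgebraUpTo_of_eqSix (k6 := kVar 5) h2 h3 h4 hs (Ideal.subset_span (by simp))
  have h7 := mem_subalgebraUpTo_of_eqSeven (k7 := kVar 6) h2 h3 h4 h5 hs
    (Ideal.subset_span (by simp))
  have h8 := mem_subalgebraUpTo_of_eqEight (k8 := kVar 7) h2 h3 h4 h5 h6 hs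
    (Ideal.subset_span (by simp))
  fin_cases i <;> assumption

/-! ### Dimension -/

/-- Incomparability makes contraction of primes strictly monotone, giving ≤; lying over and going up
lift chains of primes, giving ≥. -/
theorem ringKrullDim_eq_of_isIntegral (R S : Type*) [CommRing R] [CommRing S] [Algebra R S]
    [Algebra.IsIntegral R S] [FaithfulSMul R S] : ringKrullDim S = ringKrullDim R := by
  refine le_antisymm ?_ ?_
  · exact Order.krullDim_le_of_strictMono (PrimeSpectrum.comap (algebraMap R S))
      fun I J h => Ideal.IsIntegral.comap_lt_comap (R := R) h
  · refine iSup_le fun l => ?_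
    obtain ⟨⟨P, hP, hPl⟩⟩ := Ideal.nonempty_primesOver (S := S) l.head.asIdeal
    obtain ⟨L, hL, -⟩ := Ideal.exists_ltSeries_of_hasGoingUp l P
    rw [← hL]
    exact Order.LTSeries.length_le_krullDim L

/-- The Krull dimension of a finitely generated domain over a field is its transcendence
degree. -/
theorem ringKrullDim_eq_of_trdeg_eq {k A : Type} [Field k] [CommRing A] [IsDomain A] [Algebra k A]
    [Algebra.FiniteType k A] {n : ℕ} (h : Algebra.trdeg k A = n) : ringKrullDim A = n := by
  -- Noether normalization: A is integral over a polynomial ring in s variables, and both invariants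
  -- equal s.
  obtain ⟨s, g, hg, hint⟩ := exists_integral_inj_algHom_of_fg k A
  algebraize [g.toRingHom]
  have : FaithfulSMul (MvPolynomial (Fin s) k) A :=
    (faithfulSMul_iff_algebraMap_injective _ _).mpr hg
  have : Algebra.IsIntegral (MvPolynomial (Fin s) k) A := ⟨hint⟩
  have : IsScalarTower k (MvPolynomial (Fin s) k) A :=
    IsScalarTower.of_algebraMap_eq fun x => (g.commutes x).symm
  have htr := trdeg_add_eq k (MvPolynomial (Fin s) k) (A := A)
  rw [trdeg_eq_zero (R := MvPolynomial (Fin s) k), add_zero, h, MvPolynomial.trdeg_of_isDomain] at htr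
  have hs : s = n := by simpa using htr
  rw [ringKrullDim_eq_of_isIntegral (MvPolynomial (Fin s) k) A,
    MvPolynomial.ringKrullDim_of_isNoetherianRing, ringKrullDim_eq_zero_of_field, hs]
  simp

theorem X_dvd_sub_aeval_update {n : ℕ} (i : Fin n) (F : MvPolynomial (Fin n) ℂ) :
    X i ∣ F - aeval (Function.update X i 0) F := by
  induction F using MvPolynomial.induction_on with
  | C a => simp
  | add p q hp hq =>
    rw [map_add, add_sub_add_comm]
    exact dvd_add hp hq
  | mul_X p j hp =>
    rw [map_mul, aeval_X]
    by_cases hj : j = i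
    · subst hj
      simp
    · rw [Function.update_of_ne hj, ← sub_mul]
      exact hp.mul_right _

theorem eval_aeval_update {n : ℕ} (i : Fin n) (F : MvPolynomial (Fin n) ℂ) (z : Fin n → ℂ) :
    eval z (aeval (Function.update X i 0) F) = eval (Function.update z i 0) F := by
  rw [← coe_aeval_eq_eval, ← coe_aeval_eq_eval, RingHom.coe_coe, RingHom.coe_coe,
    ← AlgHom.comp_apply]
  congr 1
  ext j
  by_cases hj : j = i
  · subst hj; simp
  · simp [Function.update_of_ne hj]

/-- Mixtures with vanishing third cumulant have arbitrary nonzero fourth and fifth cumulants. -/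
theorem exists_symmetric_parameters {a b : ℂ} (ha : a ≠ 0) (hb : b ≠ 0) :
    ∃ s p : ℂ, p * (s ^ 2 - 3 * p) = a ∧ p * s * (s ^ 2 - 2 * p) = b := by
  -- With q = p/s² the equations read s⁴q(1-3q) = a and s⁵q(1-2q) = b. Eliminating s through a⁵/b⁴
  -- leaves this polynomial condition on q.
  let f : Polynomial ℂ := Polynomial.C (b ^ 4) * Polynomial.X *
    (1 - Polynomial.C 3 * Polynomial.X) ^ 5 -
      Polynomial.C (a ^ 5) * (1 - Polynomial.C 2 * Polynomial.X) ^ 4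
  have hroot : ∃ q, f.IsRoot q := by
    by_contra! hno
    have hdeg : f.degree = 0 := by
      by_contra h
      obtain ⟨q, hq⟩ := IsAlgClosed.exists_root f h
      exact hno q hq
    have hc : ∀ x, f.eval x = f.coeff 0 := by
      intro x
      rw [Polynomial.eq_C_of_degree_eq_zero hdeg]
      simp
    -- The values at 0 and 1/3 are -a⁵ and -a⁵/81, so f is not constant.
    have h := (hc 0).trans (hc (1 / 3)).symm
    norm_num [f] at h
    apply ha
    have h' : a ^ 5 = 0 := by linear_combination (81 / 80) * h
    exact pow_eq_zero_iff (by norm_num) |>.mp h'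
  obtain ⟨q, hq⟩ := hroot
  have hq' : b ^ 4 * q * (1 - 3 * q) ^ 5 = a ^ 5 * (1 - 2 * q) ^ 4 := by
    simpa [f, Polynomial.IsRoot, sub_eq_zero] using hq
  have h2 : 1 - 2 * q ≠ 0 := by
    intro h
    have hq2 : q = 1 / 2 := by linear_combination (-1 / 2) * h
    rw [hq2] at hq'
    norm_num at hq'
    exact hb hq'
  have h3 : 1 - 3 * q ≠ 0 := by
    intro h
    have hq3 : q = 1 / 3 := by linear_combination (-1 / 3) * h
    rw [hq3] at hq'
    norm_num at hq'
    exact ha hq'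
  have hd : a * (1 - 2 * q) ≠ 0 := mul_ne_zero ha h2
  -- The quotient of the two equations, b/a = s(1-2q)/(1-3q), determines s.
  obtain ⟨s, hs⟩ : ∃ s, s * (a * (1 - 2 * q)) = b * (1 - 3 * q) :=
    ⟨b * (1 - 3 * q) / (a * (1 - 2 * q)), div_mul_cancel₀ _ hd⟩
  have h4 : s ^ 4 * q * (1 - 3 * q) = a := by
    refine mul_left_cancel₀ (pow_ne_zero 4 hd) ?_
    have hs4 : (s * (a * (1 - 2 * q))) ^ 4 = (b * (1 - 3 * q)) ^ 4 := by rw [hs]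
    linear_combination hq' + q * (1 - 3 * q) * hs4
  refine ⟨s, s ^ 2 * q, by linear_combination h4, mul_left_cancel₀ h3 ?_⟩
  linear_combination s * (1 - 2 * q) * h4 + hs

/-- Powers of k₃ can be stripped from a relation, since the kernel is prime and omits k₃. The
remaining factor vanishes at every point with k₃ = 0 and k₄k₅ ≠ 0, as all of these are attained; so
k₃ divides it, a contradiction. -/
theorem ker_mixtureMap_five : RingHom.ker (mixtureMap 5) = ⊥ := by
  rw [eq_bot_iff]
  intro F hF
  by_contra hF0
  have hF0 : F ≠ 0 := hF0
  have hX : ¬ IsUnit (X 2 : MvPolynomial (Fin 5) ℂ) := X_prime.not_isUnit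
  obtain ⟨c, hc, hdvd⟩ := (FiniteMultiplicity.of_not_isUnit hX hF0).exists_eq_pow_mul_and_not_dvd
  have hcker : c ∈ RingHom.ker (mixtureMap 5) := by
    rw [RingHom.mem_ker, hc, map_mul, map_pow] at hF
    exact (mul_eq_zero.mp hF).resolve_left (pow_ne_zero _ (mixtureMap_X_two_ne_zero rfl))
  rw [mem_ker_mixtureMap] at hcker
  refine hdvd ?_
  have hzero : aeval (Function.update X 2 0) c = (0 : MvPolynomial (Fin 5) ℂ) := by
    refine eq_zero_of_eval_eq_zero_of_ne (mul_ne_zero (X_ne_zero 3) (X_ne_zero 4)) fun z hz => ?_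
    rw [map_mul, eval_X, eval_X, mul_ne_zero_iff] at hz
    obtain ⟨s, p, h4, h5⟩ := exists_symmetric_parameters
      (mul_ne_zero (by norm_num : (3 / 2 : ℂ) ≠ 0) hz.1)
      (mul_ne_zero (by norm_num : (3 / 2 : ℂ) ≠ 0) hz.2)
    -- For r = -s/3 the third cumulant vanishes, and k₄ = (2/3)p(s²-3p), k₅ = (2/3)ps(s²-2p); hence
    -- the factors 3/2 above.
    have hz : Function.update z 2 0 = mixturePoint 5 ![z 0, z 1, s, p, -s / 3] := by
      ext i
      fin_cases i
      · simp [mixturePoint, mixtureCumulant]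
      · simp [mixturePoint, mixtureCumulant]
      · simp [mixturePoint, mixtureCumulant, skewCumulant]; ring
      · simp [mixturePoint, mixtureCumulant, skewCumulant]
        linear_combination (-2 / 3) * h4
      · simp [mixturePoint, mixtureCumulant, skewCumulant]
        linear_combination (-2 / 3) * h5
    rw [eval_aeval_update, hz, hcker]
  have := X_dvd_sub_aeval_update 2 c
  rwa [hzero, sub_zero] at this

theorem ringKrullDim_quotient_secantIdeal {d : ℕ} (h5 : 5 ≤ d) (h8 : d ≤ 8) :
    ringKrullDim (MvPolynomial (Fin d) ℂ ⧸ secantIdeal d) = 5 := by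
  rw [secantIdeal_eq_ker h8]
  have hprime : (RingHom.ker (mixtureMap d)).IsPrime := RingHom.ker_isPrime _
  refine ringKrullDim_eq_of_trdeg_eq (k := ℂ) (n := 5) (le_antisymm ?_ ?_)
  · have h := trdeg_le_of_injective (Ideal.kerLiftAlg (mixtureMap d))
      (Ideal.kerLiftAlg_injective _)
    simpa using h
  · let x : Fin 5 → MvPolynomial (Fin d) ℂ ⧸ RingHom.ker (mixtureMap d) :=
      fun j => Ideal.Quotient.mk _ (X (Fin.castLE h5 j))
    have hx : AlgebraicIndependent ℂ x := by
      -- Independence is tested on the images in the parameter ring, where it is injectivity of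
      -- `mixtureMap 5`.
      refine AlgebraicIndependent.of_comp (Ideal.kerLiftAlg (mixtureMap d)) ?_
      have e : Ideal.kerLiftAlg (mixtureMap d) ∘ x =
          fun i : Fin 5 => mixtureCumulant (X 0) (X 1) (X 2) (X 3) (X 4) (i : ℕ) := by
        funext j
        exact (Ideal.kerLiftAlg_mk (mixtureMap d) _).trans (aeval_X _ _)
      rw [e]
      exact (injective_iff_map_eq_zero _).mpr fun F hF =>
        (Submodule.mem_bot _).mp (ker_mixtureMap_five.le hF)
    simpa using hx.cardinalMk_le_trdeg

theorem mainTheorem10 :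
    (ringKrullDim (MvPolynomial (Fin 7) ℂ ⧸ secantIdeal 7) = 5 ∧
      secantIdeal 7 = saturate (eliminate systemSeven) (X 2) ∧
      secantIdeal 7 = eliminate (saturate systemSeven pVar)) ∧
    (ringKrullDim (MvPolynomial (Fin 8) ℂ ⧸ secantIdeal 8) = 5 ∧
      secantIdeal 8 = saturate (eliminate systemEight) (X 2) ∧
      secantIdeal 8 = eliminate (saturate systemEight pVar)) := by
  have h7 := secantIdeal_eq_ker (d := 7) (by norm_num)
  have h8 := secantIdeal_eq_ker (d := 8) le_rfl
  refine ⟨⟨ringKrullDim_quotient_secantIdeal (by norm_num) (by norm_num), h7.trans ?_,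
    h7.trans ?_⟩, ringKrullDim_quotient_secantIdeal (by norm_num) le_rfl, h8.trans ?_,
    h8.trans ?_⟩
  · exact ker_mixtureMap_eq_saturate_eliminate (i₀ := 0) (i₁ := 1) (i₃ := 3) rfl rfl rfl
      eval_systemPoint_eq_zero_of_mem_systemSeven kVar_mem_reducibleSubalgebra_systemSeven
      (Ideal.subset_span (by simp))
  · exact ker_mixtureMap_eq_eliminate_saturate (i₀ := 0) (i₁ := 1) (i₂ := 2) rfl rfl rfl
      eval_systemPoint_eq_zero_of_mem_systemSeven kVar_mem_reducibleSubalgebra_systemSeven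
  · exact ker_mixtureMap_eq_saturate_eliminate (i₀ := 0) (i₁ := 1) (i₃ := 3) rfl rfl rfl
      eval_systemPoint_eq_zero_of_mem_systemEight kVar_mem_reducibleSubalgebra_systemEight
      (Ideal.subset_span (by simp))
  · exact ker_mixtureMap_eq_eliminate_saturate (i₀ := 0) (i₁ := 1) (i₂ := 2) rfl rfl rfl
      eval_systemPoint_eq_zero_of_mem_systemEight kVar_mem_reducibleSubalgebra_systemEight
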